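/- Fix an integer $d\ge 1$ and work in $\mathbb R^d$ with the Euclidean norm; $B(x,\delta)$ is the open ball of centre $x$ and radius $\delta$, and $N_\delta(A)$ is the least number of open balls of radius $\delta$ needed to cover the bounded set $A\subset\mathbb R^d$. For a nonempty set $F\subset\mathbb R^d$ and $\theta\in(0,1)$, the Assouad spectrum of $F$ is $$\dim_{\mathrm A}^{\theta}F=\inf\Bigl\{\alpha:(\exists C>0)(\forall\,0<\delta\le 1)(\forall x\in F)\;\;N_{\delta^{1/\theta}}(F\cap B(x,\delta))\le C\Bigl(\frac{\delta}{\delta^{1/\theta}}\Bigr)^{\alpha}\Bigr\},$$ and the upper Assouad spectrum of $F$ is $$\overline{\dim}_{\mathrm A}^{\theta}F=\inf\Bigl\{\alpha:(\exists C>0)(\forall\,0<\delta\le 1)(\forall\,0<\delta'\le\delta^{1/\theta})(\forall x\in F)\;\;N_{\delta'}(F\cap B(x,\delta))\le C\Bigl(\frac{\delta}{\delta'}\Bigr)^{\alpha}\Bigr\}.$$ Let $\mathcal A_d$ be the set of functions $\varphi\colon(0,1)\to[0,d]$ such that for all $0<\lambda<\theta<1$, $$0\le(1-\lambda)\varphi(\lambda)-(1-\theta)\varphi(\theta)\le(\theta-\lambda)\,\varphi\Bigl(\frac{\lambda}{\theta}\Bigr).$$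 ("Increasing" and "decreasing" are meant in the weak sense.) **Theorem.** Let $\varphi\colon(0,1)\to[0,d]$ satisfy at least one of the following (equivalent) conditions: (i) $\varphi\in\mathcal A_d$ and $\varphi$ is increasing; (ii) there is a nonempty set $G\subset\mathbb R^d$ with $\overline{\dim}_{\mathrm A}^{\theta}G=\varphi(\theta)$ for all $\theta\in(0,1)$; (iii) $\varphi$ is increasing and $\theta\mapsto(1-\theta)\varphi(\theta)$ is decreasing on $(0,1)$; (iv) $\varphi$ is the pointwise supremum of a nonempty family of functions of the form $\theta\mapsto f(\theta)/(1-\theta)$, where $f(\theta)=\kappa(1-c)$ for $0<\theta\le c$ and $f(\theta)=\kappa(1-\theta)$ for $c<\theta<1$, with $\kappa\in[0,d]$ and $c\in(0,1)$. Then for every $\varepsilon>0$ there is a nonempty compact set $F\subset\mathbb R^d$ such that the function $\theta\mapsto\dim_{\mathrm A}^{\theta}F$ is neither increasing nor decreasing on any nonempty open subset of $(0,1)$, and $$\sup_{\theta\in(0,1)}\bigl|\dim_{\mathrm A}^{\theta}F-\varphi(\theta)\bigr|<\varepsilon .$$ -/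

import Mathlib

open Set Metric

noncomputable section

/-- `coveringCount δ A` is `N_δ(A)`: the least number of open balls of radius `δ` (with arbitrary
centres in the ambient space) needed to cover `A`. It is only ever used for `δ > 0` and bounded
subsets `A` of a Euclidean space, where a finite cover exists. -/
def coveringCount {d : ℕ} (δ : ℝ) (A : Set (EuclideanSpace ℝ (Fin d))) : ℕ :=
  sInf {n : ℕ | ∃ t : Finset (EuclideanSpace ℝ (Fin d)), t.card = n ∧ A ⊆ ⋃ y ∈ t, ball y δ}

/-- The Assouad spectrum of `F ⊆ ℝ^d` at `θ ∈ (0,1)`. For nonempty `F` every admissible exponent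
`α` is nonnegative and `α = d` is admissible, so this is a genuine infimum. -/
def assouadSpectrum {d : ℕ} (F : Set (EuclideanSpace ℝ (Fin d))) (θ : ℝ) : ℝ :=
  sInf {α : ℝ | ∃ C : ℝ, 0 < C ∧ ∀ δ : ℝ, 0 < δ → δ ≤ 1 → ∀ x ∈ F,
    (coveringCount (δ ^ (1 / θ)) (F ∩ ball x δ) : ℝ) ≤ C * (δ / δ ^ (1 / θ)) ^ α}

/-- The upper Assouad spectrum of `F ⊆ ℝ^d` at `θ ∈ (0,1)`: the lower scale `δ'` is only bounded
above by `δ ^ (1/θ)`. As before this is a genuine infimum for nonempty `F`. -/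
def upperAssouadSpectrum {d : ℕ} (F : Set (EuclideanSpace ℝ (Fin d))) (θ : ℝ) : ℝ :=
  sInf {α : ℝ | ∃ C : ℝ, 0 < C ∧ ∀ δ : ℝ, 0 < δ → δ ≤ 1 →
    ∀ δ' : ℝ, 0 < δ' → δ' ≤ δ ^ (1 / θ) → ∀ x ∈ F,
      (coveringCount δ' (F ∩ ball x δ) : ℝ) ≤ C * (δ / δ') ^ α}

/-- The class `𝒜_d` of functions `φ : (0,1) → [0,d]` such that for all `0 < λ < θ < 1`,
`0 ≤ (1-λ) φ(λ) - (1-θ) φ(θ) ≤ (θ-λ) φ(λ/θ)`. Only the values of `φ` on `(0,1)` matter. -/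
def ClassA (d : ℕ) (φ : ℝ → ℝ) : Prop :=
  (∀ θ ∈ Ioo (0 : ℝ) 1, φ θ ∈ Icc (0 : ℝ) d) ∧
  ∀ l θ : ℝ, 0 < l → l < θ → θ < 1 →
    0 ≤ (1 - l) * φ l - (1 - θ) * φ θ ∧
    (1 - l) * φ l - (1 - θ) * φ θ ≤ (θ - l) * φ (l / θ)

/-- `φ` is, on `(0,1)`, the upper Assouad spectrum of some (nonempty) subset of `ℝ^d`. -/
def IsUpperAssouadSpectrum (d : ℕ) (φ : ℝ → ℝ) : Prop :=
  ∃ F : Set (EuclideanSpace ℝ (Fin d)), F.Nonempty ∧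
    ∀ θ ∈ Ioo (0 : ℝ) 1, upperAssouadSpectrum F θ = φ θ

/-- `φ` is increasing and `θ ↦ (1-θ) φ(θ)` is decreasing on `(0,1)` (both in the weak sense). -/
def IncreasingWithDecreasingRate (φ : ℝ → ℝ) : Prop :=
  MonotoneOn φ (Ioo 0 1) ∧ AntitoneOn (fun θ => (1 - θ) * φ θ) (Ioo 0 1)

/-- The function equal to `κ (1-c)` on `(0,c]` and to `κ (1-θ)` on `(c,1)`. -/
def elementaryFun (κ c θ : ℝ) : ℝ :=
  if θ ≤ c then κ * (1 - c) else κ * (1 - θ)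

/-- `φ` is, on `(0,1)`, the pointwise supremum of a family of functions
`θ ↦ elementaryFun κ c θ / (1-θ)` with `κ ∈ [0,d]` and `c ∈ (0,1)`. -/
def IsSupOfElementary (d : ℕ) (φ : ℝ → ℝ) : Prop :=
  ∃ S : Set (ℝ × ℝ), S ⊆ Icc (0 : ℝ) d ×ˢ Ioo (0 : ℝ) 1 ∧
    ∀ θ ∈ Ioo (0 : ℝ) 1,
      IsLUB ((fun p : ℝ × ℝ => elementaryFun p.1 p.2 θ / (1 - θ)) '' S) (φ θ)

/-- `f` is non-monotonic on every nonempty open subset of `(0,1)`: on no such set is it increasing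
or decreasing, even in the weak sense. -/
def NonMonotoneOnEveryOpen (f : ℝ → ℝ) : Prop :=
  ∀ U : Set ℝ, IsOpen U → U.Nonempty → U ⊆ Ioo 0 1 → ¬ MonotoneOn f U ∧ ¬ AntitoneOn f U

end

/-! Each of the four hypotheses implies `IncreasingWithDecreasingRate φ`. What remains splits into
an analytic half and a geometric half.

Analytic half (`exists_classA_near`): membership in 𝒜_d does not force monotonicity. A small
perturbation `base` of `φ` increases, and has `(1-x) * base x` decreasing, both at a definite linear
rate. This leaves room for oscillation: every `g` in the thin strip above `base` that satisfies
suitable one-sided slope bounds lies in 𝒜_d (`SlopeBounded.classA_of_increasing`). These bounds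
survive maxima and limits of increasing sequences, so peaks of rapidly shrinking height can be
inserted near a dense set of points without leaving the strip (`exists_nonMonotoneOnEveryOpen`). The
limit has, in every open set, a point strictly higher than some point on either side of it.

Geometric half (`assouadSpectrum_digitCube`): each `g` in 𝒜_d is the Assouad spectrum of a compact
set. With `ψ = g / d`, take the numbers whose binary digits are supported on a set of positions, and
form the `d`-fold product. Covering a ball of radius `2 ^ (-X)` at scale `2 ^ (-X / θ)` costs, up to
constants, `2 ^ d` for each permitted position between `X` and `X / θ`. The positions lie in widely
separated blocks, and in a block ending at `N` their counting function is a rescaled copy of `-(1-t)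
* ψ t`, up to an additive constant. The 𝒜 inequalities say exactly that this function increases and
gains at most `ψ θ * (X / θ - X)` over such a window; equality holds when `X = θ * N`. -/

/-! ### Covering numbers in Euclidean space -/

theorem EuclideanSpace.norm_le_card_mul {d : ℕ} {h : ℝ} {x : EuclideanSpace ℝ (Fin d)}
    (hx : ∀ i, |x i| ≤ h) : ‖x‖ ≤ d * h := by
  rcases Nat.eq_zero_or_pos d with rfl | hd
  · have : x = 0 := Subsingleton.elim _ _
    simp [this]
  have hh : 0 ≤ h := (abs_nonneg _).trans (hx ⟨0, hd⟩)
  have hd' : (1 : ℝ) ≤ d := by exact_mod_cast hd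
  rw [EuclideanSpace.norm_eq]
  apply Real.sqrt_le_iff.2 ⟨by positivity, ?_⟩
  calc ∑ i, ‖x i‖ ^ 2 ≤ ∑ _i : Fin d, h ^ 2 :=
        Finset.sum_le_sum fun i _ => by
          rw [Real.norm_eq_abs]
          exact pow_le_pow_left₀ (abs_nonneg _) (hx i) 2
    _ = d * h ^ 2 := by simp
    _ ≤ (d * h) ^ 2 := by
        rw [mul_pow]
        exact mul_le_mul_of_nonneg_right (by nlinarith) (sq_nonneg h)

theorem EuclideanSpace.abs_apply_le_norm {d : ℕ} (x : EuclideanSpace ℝ (Fin d)) (i : Fin d) :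
    |x i| ≤ ‖x‖ := by
  simpa [Real.norm_eq_abs] using PiLp.norm_apply_le x i

theorem coveringCount_le_card {d : ℕ} {δ : ℝ} {A : Set (EuclideanSpace ℝ (Fin d))}
    (t : Finset (EuclideanSpace ℝ (Fin d))) (h : A ⊆ ⋃ y ∈ t, ball y δ) :
    coveringCount δ A ≤ t.card :=
  Nat.sInf_le ⟨t, rfl, h⟩

theorem exists_card_eq_coveringCount {d : ℕ} {δ : ℝ} (hδ : 0 < δ)
    {A : Set (EuclideanSpace ℝ (Fin d))} (hA : Bornology.IsBounded A) :
    ∃ t : Finset (EuclideanSpace ℝ (Fin d)), t.card = coveringCount δ A ∧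
      A ⊆ ⋃ y ∈ t, ball y δ := by
  apply Nat.sInf_mem (s := {n : ℕ | ∃ t : Finset (EuclideanSpace ℝ (Fin d)), t.card = n ∧
    A ⊆ ⋃ y ∈ t, ball y δ})
  obtain ⟨t, ht, htA⟩ := Metric.totallyBounded_iff.1
    ((Bornology.IsBounded.isCompact_closure hA).totallyBounded.subset subset_closure) δ hδ
  exact ⟨ht.toFinset.card, ht.toFinset, rfl, by simpa using htA⟩

theorem coveringCount_mono {d : ℕ} {δ₁ δ₂ : ℝ} {A B : Set (EuclideanSpace ℝ (Fin d))}
    (hδ : 0 < δ₁) (hδ' : δ₁ ≤ δ₂) (hB : Bornology.IsBounded B) (hAB : A ⊆ B) :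
    coveringCount δ₂ A ≤ coveringCount δ₁ B := by
  obtain ⟨t, ht, htB⟩ := exists_card_eq_coveringCount hδ hB
  rw [← ht]
  refine coveringCount_le_card t ((hAB.trans htB).trans ?_)
  exact iUnion₂_mono fun y _ => ball_subset_ball hδ'

theorem one_le_coveringCount {d : ℕ} {δ : ℝ} (hδ : 0 < δ)
    {A : Set (EuclideanSpace ℝ (Fin d))} (hA : Bornology.IsBounded A) (hne : A.Nonempty) :
    1 ≤ coveringCount δ A := by
  obtain ⟨t, ht, htA⟩ := exists_card_eq_coveringCount hδ hA
  rw [← ht, Nat.one_le_iff_ne_zero, Finset.card_ne_zero]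
  obtain ⟨x, hx⟩ := hne
  obtain ⟨y, hy, -⟩ := mem_iUnion₂.1 (htA hx)
  exact ⟨y, hy⟩

/-- A set whose coordinates are within `h` of `M` numbers each is covered by `M ^ d` balls. -/
theorem coveringCount_le_pow {d M : ℕ} {δ h : ℝ} {A : Set (EuclideanSpace ℝ (Fin d))}
    (t : Fin d → Finset ℝ) (hh : d * h < δ) (ht : ∀ i, (t i).card ≤ M)
    (hA : ∀ y ∈ A, ∀ i, ∃ c ∈ t i, |y i - c| ≤ h) : coveringCount δ A ≤ M ^ d := by
  classical
  refine (coveringCount_le_card ((Fintype.piFinset t).image fun c => WithLp.toLp 2 c) ?_).trans ?_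
  · intro y hy
    choose c hc hyc using hA y hy
    refine mem_iUnion₂.2 ⟨WithLp.toLp 2 c, Finset.mem_image.2
      ⟨c, Fintype.mem_piFinset.2 hc, rfl⟩, ?_⟩
    rw [mem_ball, dist_eq_norm]
    exact (EuclideanSpace.norm_le_card_mul fun i => by simpa using hyc i).trans_lt hh
  · refine Finset.card_image_le.trans ?_
    rw [Fintype.card_piFinset]
    exact (Finset.prod_le_prod' fun i _ => ht i).trans (by simp)

/-- A ball of radius `δ` contains at most one point of a `2δ`-separated family. -/
theorem card_le_coveringCount {d : ℕ} {δ : ℝ} (hδ : 0 < δ) {ι : Type*} [Fintype ι]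
    {A : Set (EuclideanSpace ℝ (Fin d))} (hA : Bornology.IsBounded A)
    (P : ι → EuclideanSpace ℝ (Fin d)) (hP : ∀ i, P i ∈ A)
    (hsep : ∀ i j, i ≠ j → 2 * δ ≤ dist (P i) (P j)) : Fintype.card ι ≤ coveringCount δ A := by
  obtain ⟨t, ht, htA⟩ := exists_card_eq_coveringCount hδ hA
  have : ∀ i, ∃ y ∈ t, P i ∈ ball y δ := fun i => by simpa using htA (hP i)
  choose c hct hc using this
  rw [← ht, ← Finset.card_univ]
  refine Finset.card_le_card_of_injOn c (fun i _ => hct i) fun i _ j _ hij => ?_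
  by_contra hne
  have h1 := mem_ball.1 (hc i)
  have h2 := mem_ball'.1 (hc j)
  rw [← hij] at h2
  linarith [dist_triangle (P i) (c i) (P j), hsep i j hne]

/-- A grid of mesh `δ' / (d + 1)` around `x` does it. The bound makes the exponent `d` admissible,
so the infima defining the upper spectrum are over nonempty sets. -/
theorem coveringCount_inter_ball_le {d : ℕ} {δ δ' : ℝ} (hδ' : 0 < δ') (hδ : δ' ≤ δ)
    (A : Set (EuclideanSpace ℝ (Fin d))) (x : EuclideanSpace ℝ (Fin d)) :
    (coveringCount δ' (A ∩ ball x δ) : ℝ) ≤ (2 * d + 5) ^ d * (δ / δ') ^ d := by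
  classical
  set h : ℝ := δ' / (d + 1) with hdef
  have hd1 : (0 : ℝ) < d + 1 := by positivity
  have hh : 0 < h := by positivity
  have hhδ : h * (d + 1) = δ' := by rw [hdef]; field_simp
  set N : ℕ := ⌈δ / h⌉₊
  have hN : δ / h ≤ N := Nat.le_ceil _
  have key : coveringCount δ' (A ∩ ball x δ) ≤ (2 * N + 1) ^ d := by
    refine coveringCount_le_pow (h := h)
      (fun i => (Finset.Icc (-(N : ℤ)) N).image fun k : ℤ => x i + k * h) (by linarith) ?_ ?_
    · intro i
      refine Finset.card_image_le.trans ?_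
      simp only [Int.card_Icc]
      omega
    · rintro y ⟨-, hy⟩ i
      have hyi : |y i - x i| < δ := by
        refine lt_of_le_of_lt ?_ (mem_ball_iff_norm.1 hy)
        simpa using EuclideanSpace.abs_apply_le_norm (y - x) i
      rw [abs_lt] at hyi
      have e : (y i - x i) / h * h = y i - x i := by field_simp
      have h1 := Int.floor_le ((y i - x i) / h)
      have h2 := (Int.lt_floor_add_one ((y i - x i) / h)).le
      have h1' := mul_le_mul_of_nonneg_right h1 hh.le
      have h2' := mul_le_mul_of_nonneg_right h2 hh.le
      refine ⟨_, Finset.mem_image.2 ⟨⌊(y i - x i) / h⌋, Finset.mem_Icc.2 ⟨?_, ?_⟩, rfl⟩, ?_⟩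
      · rw [Int.le_floor]
        push_cast
        rw [neg_le, ← neg_div]
        exact (div_le_div_of_nonneg_right (by linarith) hh.le).trans hN
      · have : (⌊(y i - x i) / h⌋ : ℝ) ≤ N :=
          h1.trans ((div_le_div_of_nonneg_right (by linarith) hh.le).trans hN)
        exact_mod_cast this
      · rw [abs_le]
        constructor <;> linarith
  have hδδ : 1 ≤ δ / δ' := (one_le_div hδ').2 hδ
  have hN2 : (N : ℝ) < δ / h + 1 := Nat.ceil_lt_add_one (div_nonneg (hδ'.le.trans hδ) hh.le)
  have e2 : δ / h = (d + 1) * (δ / δ') := by rw [hdef]; field_simp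
  calc (coveringCount δ' (A ∩ ball x δ) : ℝ) ≤ (2 * N + 1) ^ d := by exact_mod_cast key
    _ ≤ ((2 * d + 5) * (δ / δ')) ^ d := by
        apply pow_le_pow_left₀ (by positivity)
        rw [e2] at hN2
        linarith
    _ = _ := mul_pow _ _ _

/-! ### Upper Assouad spectra have increasing values and decreasing rate -/

/-- The exponents admissible in the definition of the upper Assouad spectrum. -/
def upperExponents {d : ℕ} (F : Set (EuclideanSpace ℝ (Fin d))) (θ : ℝ) : Set ℝ :=
  {α : ℝ | ∃ C : ℝ, 0 < C ∧ ∀ δ : ℝ, 0 < δ → δ ≤ 1 →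
    ∀ δ' : ℝ, 0 < δ' → δ' ≤ δ ^ (1 / θ) → ∀ x ∈ F,
      (coveringCount δ' (F ∩ ball x δ) : ℝ) ≤ C * (δ / δ') ^ α}

section
variable {d : ℕ} {F : Set (EuclideanSpace ℝ (Fin d))} {l θ : ℝ}

theorem rpow_one_div_le_self {δ : ℝ} (hδ : 0 < δ) (hδ1 : δ ≤ 1) (h0 : 0 < θ) (h1 : θ < 1) :
    δ ^ (1 / θ) ≤ δ := by
  simpa using Real.rpow_le_rpow_of_exponent_ge hδ hδ1 ((one_le_div h0).2 h1.le)

theorem natCast_mem_upperExponents (F : Set (EuclideanSpace ℝ (Fin d)))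
    (h0 : 0 < θ) (h1 : θ < 1) : (d : ℝ) ∈ upperExponents F θ := by
  refine ⟨(2 * d + 5) ^ d, by positivity, fun δ hδ hδ1 δ' hδ' hle x _ => ?_⟩
  rw [Real.rpow_natCast]
  exact coveringCount_inter_ball_le hδ' (hle.trans (rpow_one_div_le_self hδ hδ1 h0 h1)) F x

theorem nonneg_of_mem_upperExponents (hF : F.Nonempty) {α : ℝ}
    (hα : α ∈ upperExponents F θ) : 0 ≤ α := by
  obtain ⟨C, hC, h⟩ := hα
  obtain ⟨x, hx⟩ := hF
  by_contra! hneg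
  obtain ⟨n, hn⟩ : ∃ n : ℕ, C < (n : ℝ) := exists_nat_gt C
  have hn0 : (0 : ℝ) < n := hC.trans hn
  -- With `δ = 1` and `δ' = 1 / M`, this `M` is large enough that `C * M ^ α < 1`, although a
  -- nonempty set needs at least one ball.
  set M : ℝ := max 1 ((n : ℝ) ^ (1 / -α)) with hM
  have hM0 : 0 < M := lt_max_of_lt_left one_pos
  have h1 := h 1 one_pos le_rfl (1 / M) (by positivity)
    (by rw [Real.one_rpow]; exact (div_le_one hM0).2 (le_max_left _ _)) x hx
  have h2 : (1 : ℝ) ≤ coveringCount (1 / M) (F ∩ ball x 1) := by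
    exact_mod_cast one_le_coveringCount (by positivity)
      (isBounded_ball.subset inter_subset_right) ⟨x, hx, mem_ball_self one_pos⟩
  have h3 : (1 : ℝ) ≤ C * M ^ α := by simpa using h2.trans h1
  have h4 : (n : ℝ) ≤ M ^ (-α) := by
    calc (n : ℝ) = ((n : ℝ) ^ (1 / -α)) ^ (-α) := by
          rw [← Real.rpow_mul hn0.le, one_div, inv_mul_cancel₀ (by linarith), Real.rpow_one]
      _ ≤ M ^ (-α) := Real.rpow_le_rpow (by positivity) (le_max_right _ _) (by linarith)
  have h5 : M ^ α * M ^ (-α) = 1 := by rw [← Real.rpow_add hM0]; simp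
  have h6 : 0 < M ^ α := by positivity
  nlinarith

theorem upperExponents_antitone (h0 : 0 < l) (hlθ : l ≤ θ) :
    upperExponents F θ ⊆ upperExponents F l := by
  rintro α ⟨C, hC, h⟩
  refine ⟨C, hC, fun δ hδ hδ1 δ' hδ' hle x hx => h δ hδ hδ1 δ' hδ' (hle.trans ?_) x hx⟩
  exact Real.rpow_le_rpow_of_exponent_ge hδ hδ1 (one_div_le_one_div_of_le h0 hlθ)

/-- If `δ'` is too large for the bound at `l` to apply to the radius `δ`, enlarge the radius to `δ'
^ l`, where it does apply. The scale ratio becomes `δ' ^ (l - 1)`, which is at most the original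
ratio to the power `(1 - l) / (1 - θ)`. -/
theorem mul_mem_upperExponents (hF : F.Nonempty) (h0 : 0 < l) (hlθ : l ≤ θ) (h1 : θ < 1) {α : ℝ}
    (hα : α ∈ upperExponents F l) : α * ((1 - l) / (1 - θ)) ∈ upperExponents F θ := by
  have hα0 := nonneg_of_mem_upperExponents hF hα
  obtain ⟨C, hC, h⟩ := hα
  have hθ0 : 0 < θ := h0.trans_le hlθ
  have hq : 1 ≤ (1 - l) / (1 - θ) := (one_le_div (by linarith)).2 (by linarith)
  refine ⟨C, hC, fun δ hδ hδ1 δ' hδ' hle x hx => ?_⟩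
  have hδδ : 1 ≤ δ / δ' := (one_le_div hδ').2 (hle.trans (rpow_one_div_le_self hδ hδ1 hθ0 h1))
  rcases le_or_gt δ' (δ ^ (1 / l)) with hc | hc
  · refine (h δ hδ hδ1 δ' hδ' hc x hx).trans (mul_le_mul_of_nonneg_left ?_ hC.le)
    exact Real.rpow_le_rpow_of_exponent_le hδδ (le_mul_of_one_le_right hα0 hq)
  · have hδ'1 : δ' ≤ 1 := hle.trans (Real.rpow_le_one hδ.le hδ1 (by positivity))
    have hr : δ ≤ δ' ^ l := by
      have := Real.rpow_le_rpow (by positivity) hc.le h0.le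
      rwa [← Real.rpow_mul hδ.le, one_div, inv_mul_cancel₀ h0.ne', Real.rpow_one] at this
    have hr' : δ' ^ θ ≤ δ := by
      have := Real.rpow_le_rpow hδ'.le hle hθ0.le
      rwa [← Real.rpow_mul hδ.le, one_div, inv_mul_cancel₀ hθ0.ne', Real.rpow_one] at this
    have hl' : δ' ≤ (δ' ^ l) ^ (1 / l) := by
      rw [← Real.rpow_mul hδ'.le, mul_one_div_cancel h0.ne', Real.rpow_one]
    calc (coveringCount δ' (F ∩ ball x δ) : ℝ) ≤ coveringCount δ' (F ∩ ball x (δ' ^ l)) := by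
          exact_mod_cast coveringCount_mono hδ' le_rfl (isBounded_ball.subset inter_subset_right)
            (inter_subset_inter_right _ (ball_subset_ball hr))
      _ ≤ C * (δ' ^ l / δ') ^ α := h _ (by positivity)
          (Real.rpow_le_one hδ'.le hδ'1 h0.le) δ' hδ' hl' x hx
      _ ≤ C * (δ / δ') ^ (α * ((1 - l) / (1 - θ))) := by
          refine mul_le_mul_of_nonneg_left ?_ hC.le
          have e1 : δ' ^ l / δ' = δ' ^ (l - 1) := by rw [Real.rpow_sub hδ', Real.rpow_one]
          have e2 : δ' ^ (θ - 1) ≤ δ / δ' := by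
            rw [Real.rpow_sub hδ', Real.rpow_one]
            exact div_le_div_of_nonneg_right hr' hδ'.le
          rw [e1]
          calc (δ' ^ (l - 1)) ^ α = (δ' ^ (θ - 1)) ^ (α * ((1 - l) / (1 - θ))) := by
                rw [← Real.rpow_mul hδ'.le, ← Real.rpow_mul hδ'.le]
                congr 1
                have : 1 - θ ≠ 0 := by linarith
                field_simp
                ring
            _ ≤ _ := Real.rpow_le_rpow (by positivity) e2 (by positivity)

end

theorem IncreasingWithDecreasingRate.of_isUpperAssouadSpectrum {d : ℕ} {φ : ℝ → ℝ}
    (h : IsUpperAssouadSpectrum d φ) : IncreasingWithDecreasingRate φ := by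
  obtain ⟨F, hF, h⟩ := h
  have hbdd : ∀ θ, BddBelow (upperExponents F θ) := fun θ =>
    ⟨0, fun α hα => nonneg_of_mem_upperExponents hF hα⟩
  constructor
  · intro l hl θ hθ hlθ
    rw [← h l hl, ← h θ hθ]
    exact csInf_le_csInf (hbdd l) ⟨_, natCast_mem_upperExponents F hθ.1 hθ.2⟩
      (upperExponents_antitone hl.1 hlθ)
  · intro l hl θ hθ hlθ
    simp only
    rw [← h l hl, ← h θ hθ]
    have h1 : 0 < 1 - l := by linarith [hl.2]
    have h2 : 0 < 1 - θ := by linarith [hθ.2]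
    have key : (1 - θ) / (1 - l) * upperAssouadSpectrum F θ ≤ upperAssouadSpectrum F l := by
      refine le_csInf ⟨_, natCast_mem_upperExponents F hl.1 hl.2⟩ fun α hα => ?_
      have : upperAssouadSpectrum F θ ≤ α * ((1 - l) / (1 - θ)) :=
        csInf_le (hbdd θ) (mul_mem_upperExponents hF hl.1 hlθ hθ.2 hα)
      calc _ ≤ (1 - θ) / (1 - l) * (α * ((1 - l) / (1 - θ))) :=
            mul_le_mul_of_nonneg_left this (by positivity)
        _ = α := by field_simp
    rw [div_mul_eq_mul_div, div_le_iff₀ h1] at key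
    linarith

/-! ### The remaining hypotheses also give a decreasing rate -/

theorem elementaryFun_antitone {κ c l θ : ℝ} (hκ : 0 ≤ κ) (h : l ≤ θ) :
    elementaryFun κ c θ ≤ elementaryFun κ c l := by
  unfold elementaryFun
  split_ifs <;> nlinarith

theorem elementaryFun_div_le {κ c l θ : ℝ} (hκ : 0 ≤ κ) (hc : c < 1) (h : l ≤ θ) (hθ : θ < 1) :
    elementaryFun κ c l / (1 - l) ≤ elementaryFun κ c θ / (1 - θ) := by
  have h1 : 0 < 1 - l := by linarith
  have h2 : 0 < 1 - θ := by linarith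
  rw [div_le_div_iff₀ h1 h2]
  unfold elementaryFun
  split_ifs with h3 h4 h4
  · exact mul_le_mul_of_nonneg_left (by linarith) (mul_nonneg hκ (by linarith))
  · nlinarith [mul_nonneg hκ h2.le]
  · linarith
  · exact le_of_eq (by ring)

theorem IncreasingWithDecreasingRate.of_isSupOfElementary {d : ℕ} {φ : ℝ → ℝ}
    (h : IsSupOfElementary d φ) : IncreasingWithDecreasingRate φ := by
  obtain ⟨S, hS, h⟩ := h
  constructor
  · intro l hl θ hθ hlθ
    refine (h l hl).2 ?_
    rintro _ ⟨p, hp, rfl⟩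
    exact (elementaryFun_div_le (hS hp).1.1 (hS hp).2.2 hlθ hθ.2).trans
      ((h θ hθ).1 ⟨p, hp, rfl⟩)
  · intro l hl θ hθ hlθ
    have h1 : 0 < 1 - l := by linarith [hl.2]
    have h2 : 0 < 1 - θ := by linarith [hθ.2]
    have : φ θ ≤ (1 - l) * φ l / (1 - θ) := by
      refine (h θ hθ).2 ?_
      rintro _ ⟨p, hp, rfl⟩
      refine div_le_div_of_nonneg_right ?_ h2.le
      refine (elementaryFun_antitone (hS hp).1.1 hlθ).trans ?_
      have : elementaryFun p.1 p.2 l / (1 - l) ≤ φ l := (h l hl).1 ⟨p, hp, rfl⟩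
      rw [div_le_iff₀ h1] at this
      linarith
    rw [le_div_iff₀ h2] at this
    simp only
    linarith

theorem IncreasingWithDecreasingRate.of_classA {d : ℕ} {φ : ℝ → ℝ}
    (h : ClassA d φ) (hm : MonotoneOn φ (Ioo 0 1)) : IncreasingWithDecreasingRate φ := by
  refine ⟨hm, fun l hl θ hθ hlθ => ?_⟩
  rcases hlθ.eq_or_lt with rfl | hlt
  · exact le_rfl
  · linarith [(h.2 l θ hl.1 hlt hθ.2).1]

/-! ### Functions with one-sided slope bounds that are nowhere monotone -/

/-- One-sided slope bounds on `(0,1)`: `(1 - x) g x` is decreasing and `g x + σ x ^ 2` is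
increasing. -/
def SlopeBounded (σ : ℝ) (g : ℝ → ℝ) : Prop :=
  AntitoneOn (fun x => (1 - x) * g x) (Ioo 0 1) ∧ MonotoneOn (fun x => g x + σ * x ^ 2) (Ioo 0 1)

theorem SlopeBounded.sup {σ : ℝ} {g₁ g₂ : ℝ → ℝ} (h₁ : SlopeBounded σ g₁)
    (h₂ : SlopeBounded σ g₂) : SlopeBounded σ fun x => max (g₁ x) (g₂ x) := by
  constructor
  · intro x hx y hy hxy
    have hx' : 0 ≤ 1 - x := by linarith [hx.2]
    have hy' : 0 ≤ 1 - y := by linarith [hy.2]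
    simp only [mul_max_of_nonneg _ _ hx', mul_max_of_nonneg _ _ hy']
    exact max_le_max (h₁.1 hx hy hxy) (h₂.1 hx hy hxy)
  · intro x hx y hy hxy
    simp only [max_add]
    exact max_le_max (h₁.2 hx hy hxy) (h₂.2 hx hy hxy)

/-- The function with value `v` at `p` that falls off as fast as `SlopeBounded σ` permits. -/
noncomputable def peak (σ p v x : ℝ) : ℝ :=
  if x ≤ p then v * (1 - p) / (1 - x) else v - σ * (x ^ 2 - p ^ 2)

theorem one_sub_mul_peak {σ p v x : ℝ} (hp : p < 1) (hx : x ≤ p) :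
    (1 - x) * peak σ p v x = (1 - p) * v := by
  have : 1 - x ≠ 0 := by linarith
  rw [peak, if_pos hx]
  field_simp

theorem peak_add_sq {σ p v x : ℝ} (hx : p < x) :
    peak σ p v x + σ * x ^ 2 = v + σ * p ^ 2 := by
  rw [peak, if_neg hx.not_ge]
  ring

/-- On each side of `p` one of the two bounds is an equality. The condition `σ ≤ v` keeps the right
branch nonnegative, as `(1 - x) * peak σ p v x` needs in order to decrease there. -/
theorem slopeBounded_peak {σ p v : ℝ} (hp : p ∈ Ioo (0 : ℝ) 1) (hσ : 0 ≤ σ) (hv : σ ≤ v) :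
    SlopeBounded σ (peak σ p v) := by
  obtain ⟨hp0, hp1⟩ := hp
  constructor
  · intro x hx y hy hxy
    simp only
    rcases le_or_gt y p with hyp | hyp
    · rw [one_sub_mul_peak hp1 hyp, one_sub_mul_peak hp1 (hxy.trans hyp)]
    · have ey : peak σ p v y = v - σ * (y ^ 2 - p ^ 2) := by rw [peak, if_neg hyp.not_ge]
      have hy1 : 0 < 1 - y := by linarith [hy.2]
      have hpy : p ^ 2 ≤ y ^ 2 := pow_le_pow_left₀ hp0.le hyp.le 2
      rcases le_or_gt x p with hxp | hxp
      · rw [one_sub_mul_peak hp1 hxp, ey]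
        have : 0 ≤ (1 - y) * (σ * (y ^ 2 - p ^ 2)) :=
          mul_nonneg hy1.le (mul_nonneg hσ (by linarith))
        nlinarith
      · have ex : peak σ p v x = v - σ * (x ^ 2 - p ^ 2) := by rw [peak, if_neg hxp.not_ge]
        rw [ex, ey]
        have h1 : 0 ≤ (1 - y) * (σ * (y ^ 2 - x ^ 2)) := mul_nonneg hy1.le
          (mul_nonneg hσ (by linarith [pow_le_pow_left₀ hx.1.le hxy 2]))
        have h2 : x ^ 2 - p ^ 2 ≤ 1 := by nlinarith [hx.1, hx.2]
        have h3 : σ * (x ^ 2 - p ^ 2) ≤ v := by nlinarith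
        have h4 : 0 ≤ (y - x) * (v - σ * (x ^ 2 - p ^ 2)) :=
          mul_nonneg (by linarith) (by linarith)
        nlinarith
  · have hleft : ∀ x y : ℝ, 0 < x → x ≤ y → y ≤ p →
        peak σ p v x + σ * x ^ 2 ≤ peak σ p v y + σ * y ^ 2 := by
      intro x y hx hxy hyp
      rw [peak, peak, if_pos hyp, if_pos (hxy.trans hyp)]
      refine add_le_add (div_le_div_of_nonneg_left ?_ (by linarith) (by linarith))
        (mul_le_mul_of_nonneg_left (pow_le_pow_left₀ hx.le hxy 2) hσ)
      exact mul_nonneg (hσ.trans hv) (by linarith)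
    intro x hx y hy hxy
    simp only
    rcases le_or_gt y p with hyp | hyp
    · exact hleft x y hx.1 hxy hyp
    · rw [peak_add_sq hyp]
      rcases le_or_gt x p with hxp | hxp
      · refine (hleft x p hx.1 hxp le_rfl).trans (le_of_eq ?_)
        have : 1 - p ≠ 0 := by linarith
        rw [peak, if_pos le_rfl]
        field_simp
      · rw [peak_add_sq hxp]

theorem peak_self {σ p v : ℝ} (hp : p < 1) : peak σ p v p = v := by
  have : 1 - p ≠ 0 := by linarith
  rw [peak, if_pos le_rfl]
  field_simp

/-- A peak is minimal among slope-bounded functions with its value at `p`, so comparison at `p`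
alone suffices. This keeps new peaks below the cap. -/
theorem peak_lt {σ p v : ℝ} {g : ℝ → ℝ} (hg : SlopeBounded σ g) (hp : p ∈ Ioo (0 : ℝ) 1)
    (hv : v < g p) {x : ℝ} (hx : x ∈ Ioo (0 : ℝ) 1) : peak σ p v x < g x := by
  have hp1 : 0 < 1 - p := by linarith [hp.2]
  have hx1 : 0 < 1 - x := by linarith [hx.2]
  rcases le_or_gt x p with hxp | hxp
  · have h1 := one_sub_mul_peak (σ := σ) (v := v) hp.2 hxp
    have h2 : (1 - p) * g p ≤ (1 - x) * g x := hg.1 hx hp hxp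
    have h3 : (1 - p) * v < (1 - p) * g p := mul_lt_mul_of_pos_left hv hp1
    exact lt_of_mul_lt_mul_left (by linarith) hx1.le
  · have h1 := peak_add_sq (σ := σ) (v := v) hxp
    have h2 : g p + σ * p ^ 2 ≤ g x + σ * x ^ 2 := hg.2 hp hx hxp.le
    linarith

theorem peak_add_le {σ p v ε : ℝ} {g : ℝ → ℝ} (hg : SlopeBounded σ g) (hp : p ∈ Ioo (0 : ℝ) 1)
    (hε : 0 ≤ ε) (hv : v ≤ g p + ε) {x : ℝ} (hx : x ∈ Ioo (0 : ℝ) 1) :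
    peak σ p v x ≤ g x + ε := by
  have hp1 : 0 < 1 - p := by linarith [hp.2]
  have hx1 : 0 < 1 - x := by linarith [hx.2]
  rcases le_or_gt x p with hxp | hxp
  · have h1 := one_sub_mul_peak (σ := σ) (v := v) hp.2 hxp
    have h2 : (1 - p) * g p ≤ (1 - x) * g x := hg.1 hx hp hxp
    have h3 : (1 - p) * v ≤ (1 - p) * (g p + ε) := mul_le_mul_of_nonneg_left hv hp1.le
    have h4 : (1 - p) * ε ≤ (1 - x) * ε := mul_le_mul_of_nonneg_right (by linarith) hε
    exact le_of_mul_le_mul_left (by linarith) hx1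
  · have h1 := peak_add_sq (σ := σ) (v := v) hxp
    have h2 : g p + σ * p ^ 2 ≤ g x + σ * x ^ 2 := hg.2 hp hx hxp.le
    linarith

theorem SlopeBounded.exists_left_lt {σ p r v : ℝ} {g : ℝ → ℝ} (hg : SlopeBounded σ g)
    (hσ : 0 < σ) (hp : p ∈ Ioo (0 : ℝ) 1) (hr : 0 < r) (hv : g p < v) :
    ∃ a ∈ Ioo (0 : ℝ) 1, p - r < a ∧ a < p ∧ g a < v := by
  obtain ⟨hp0, hp1⟩ := hp
  obtain ⟨s, hs0, hs⟩ : ∃ s, 0 < s ∧ s < min p (min r ((v - g p) / (2 * σ))) :=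
    exists_between (lt_min hp0 (lt_min hr (div_pos (by linarith) (by linarith))))
  rw [lt_min_iff, lt_min_iff, lt_div_iff₀ (by linarith)] at hs
  obtain ⟨h1, h2, h3⟩ := hs
  have ha : p - s ∈ Ioo (0 : ℝ) 1 := ⟨by linarith, by linarith⟩
  refine ⟨p - s, ha, by linarith, by linarith, ?_⟩
  have h4 : g (p - s) + σ * (p - s) ^ 2 ≤ g p + σ * p ^ 2 := hg.2 ha ⟨hp0, hp1⟩ (by linarith)
  have h5 : σ * p ^ 2 - σ * (p - s) ^ 2 ≤ s * (2 * σ) := by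
    have : 0 ≤ s * σ * (2 * (1 - p) + s) := by
      have : 0 ≤ 1 - p := by linarith
      positivity
    nlinarith
  linarith

theorem SlopeBounded.exists_right_lt {σ p r v : ℝ} {g : ℝ → ℝ} (hg : SlopeBounded σ g)
    (hp : p ∈ Ioo (0 : ℝ) 1) (hr : 0 < r) (hg0 : 0 < g p) (hv : g p < v) :
    ∃ b ∈ Ioo (0 : ℝ) 1, p < b ∧ b < p + r ∧ g b < v := by
  obtain ⟨hp0, hp1⟩ := hp
  have hv0 : 0 < v := hg0.trans hv
  obtain ⟨s, hs0, hs⟩ : ∃ s, 0 < s ∧ s < min (1 - p) (min r ((1 - p) * (v - g p) / v)) :=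
    exists_between (lt_min (by linarith)
      (lt_min hr (div_pos (mul_pos (by linarith) (by linarith)) hv0)))
  rw [lt_min_iff, lt_min_iff, lt_div_iff₀ hv0] at hs
  obtain ⟨h1, h2, h3⟩ := hs
  have hb : p + s ∈ Ioo (0 : ℝ) 1 := ⟨by linarith, by linarith⟩
  refine ⟨p + s, hb, by linarith, by linarith, ?_⟩
  have h4 : (1 - (p + s)) * g (p + s) ≤ (1 - p) * g p := hg.1 ⟨hp0, hp1⟩ hb (by linarith)
  have h5 : 0 ≤ 1 - (p + s) := by linarith
  refine lt_of_mul_lt_mul_left (a := 1 - (p + s)) ?_ h5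
  nlinarith

/-- One step of the construction. The number `t` is a budget for all later raises: this step spends
at most half of it, and the new budget `t'` is too small for later raises to undo the strict
inequalities at `a`, `p`, `b`. -/
theorem SlopeBounded.exists_peak {σ : ℝ} {g cap : ℝ → ℝ} (hg : SlopeBounded σ g) (hσ : 0 < σ)
    (hcap : SlopeBounded σ cap) (hlt : ∀ x ∈ Ioo (0 : ℝ) 1, g x < cap x)
    (hge : ∀ x ∈ Ioo (0 : ℝ) 1, σ ≤ g x) {p t r : ℝ} (hp : p ∈ Ioo (0 : ℝ) 1) (ht : 0 < t)
    (hr : 0 < r) :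
    ∃ (g' : ℝ → ℝ) (t' : ℝ), SlopeBounded σ g' ∧ 0 < t' ∧ t' ≤ t / 2 ∧
      (∀ x ∈ Ioo (0 : ℝ) 1, g x ≤ g' x ∧ g' x ≤ g x + t / 2 ∧ g' x < cap x) ∧
      ∃ a ∈ Ioo (0 : ℝ) 1, ∃ b ∈ Ioo (0 : ℝ) 1, p - r < a ∧ a < p ∧ p < b ∧ b < p + r ∧
        g' a + t' < g' p ∧ g' b + t' < g' p := by
  have hgp := hge p hp
  have hcp := hlt p hp
  set ε := min (t / 2) ((cap p - g p) / 2) with hεdef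
  have hε : 0 < ε := lt_min (by linarith) (by linarith)
  have hεt : ε ≤ t / 2 := min_le_left _ _
  have hεc : ε ≤ (cap p - g p) / 2 := min_le_right _ _
  set v := g p + ε with hv
  have hP := slopeBounded_peak hp hσ.le (show σ ≤ v by linarith)
  obtain ⟨a, ha, har, hap, hav⟩ := hg.exists_left_lt hσ hp hr (show g p < v by linarith)
  obtain ⟨b, hb, hpb, hbr, hbv⟩ := hg.exists_right_lt hp hr (by linarith)
    (show g p < v by linarith)
  have hPa : peak σ p v a < v := by
    have := one_sub_mul_peak (σ := σ) (v := v) hp.2 hap.le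
    refine lt_of_mul_lt_mul_left (a := 1 - a) ?_ (by linarith [ha.2])
    rw [this]
    exact mul_lt_mul_of_pos_right (by linarith) (by linarith)
  have hPb : peak σ p v b < v := by
    have := peak_add_sq (σ := σ) (v := v) hpb
    have : σ * p ^ 2 < σ * b ^ 2 :=
      mul_lt_mul_of_pos_left (pow_lt_pow_left₀ hpb hp.1.le two_ne_zero) hσ
    linarith
  have hvp : max (g p) (peak σ p v p) = v := by
    rw [peak_self hp.2]
    exact max_eq_right (by linarith)
  -- The higher of the two new side values; half its distance to `v` bounds the remaining budget.
  set m := max (max (g a) (peak σ p v a)) (max (g b) (peak σ p v b)) with hm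
  have hmv : m < v := max_lt (max_lt hav hPa) (max_lt hbv hPb)
  refine ⟨fun x => max (g x) (peak σ p v x), min (t / 2) ((v - m) / 2), hg.sup hP,
    lt_min (by linarith) (by linarith), min_le_left _ _, fun x hx => ⟨le_max_left _ _, ?_, ?_⟩,
    a, ha, b, hb, har, hap, hpb, hbr, ?_, ?_⟩
  · refine max_le (by linarith) ?_
    linarith [peak_add_le hg hp hε.le (le_of_eq hv) hx]
  · exact max_lt (hlt x hx) (peak_lt hcap hp (by linarith) hx)
  · have h1 : min (t / 2) ((v - m) / 2) ≤ (v - m) / 2 := min_le_right _ _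
    have h2 : max (g a) (peak σ p v a) ≤ m := le_max_left _ _
    simp only [hvp]
    linarith
  · have h1 : min (t / 2) ((v - m) / 2) ≤ (v - m) / 2 := min_le_right _ _
    have h2 : max (g b) (peak σ p v b) ≤ m := le_max_right _ _
    simp only [hvp]
    linarith

theorem exists_nonMonotoneOnEveryOpen {σ : ℝ} {base cap : ℝ → ℝ} (hσ : 0 < σ)
    (hbase : SlopeBounded σ base) (hcap : SlopeBounded σ cap)
    (hlt : ∀ x ∈ Ioo (0 : ℝ) 1, base x < cap x) (hge : ∀ x ∈ Ioo (0 : ℝ) 1, σ ≤ base x) :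
    ∃ g : ℝ → ℝ, SlopeBounded σ g ∧ (∀ x ∈ Ioo (0 : ℝ) 1, base x ≤ g x ∧ g x ≤ cap x) ∧
      NonMonotoneOnEveryOpen g := by
  let State := {s : (ℝ → ℝ) × ℝ // SlopeBounded σ s.1 ∧ 0 < s.2 ∧
    ∀ x ∈ Ioo (0 : ℝ) 1, base x ≤ s.1 x ∧ s.1 x < cap x}
  have : Nonempty (Ioo (0 : ℝ) 1) := ⟨⟨1 / 2, by norm_num, by norm_num⟩⟩
  -- Unpairing `n` makes every pair of a dense point and a radius `1 / (j + 1)` occur at some stage.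
  let p : ℕ → ℝ := fun n => (TopologicalSpace.denseSeq (Ioo (0 : ℝ) 1) n.unpair.1 : ℝ)
  have hp : ∀ n, p n ∈ Ioo (0 : ℝ) 1 := fun n => Subtype.coe_prop _
  let r : ℕ → ℝ := fun n => 1 / ((n.unpair.2 : ℝ) + 1)
  have hr : ∀ n, 0 < r n := fun n => by positivity
  have step : ∀ (n : ℕ) (s : State), ∃ s' : State, s'.1.2 ≤ s.1.2 / 2 ∧
      (∀ x ∈ Ioo (0 : ℝ) 1, s.1.1 x ≤ s'.1.1 x ∧ s'.1.1 x ≤ s.1.1 x + s.1.2 / 2) ∧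
      ∃ a ∈ Ioo (0 : ℝ) 1, ∃ b ∈ Ioo (0 : ℝ) 1, p n - r n < a ∧ a < p n ∧ p n < b ∧
        b < p n + r n ∧ s'.1.1 a + s'.1.2 < s'.1.1 (p n) ∧ s'.1.1 b + s'.1.2 < s'.1.1 (p n) := by
    rintro n ⟨⟨g, t⟩, hg, ht, hb⟩
    obtain ⟨g', t', hg', ht', htt, hb', hab⟩ := hg.exists_peak hσ hcap (fun x hx => (hb x hx).2)
      (fun x hx => (hge x hx).trans (hb x hx).1) (hp n) ht (hr n)
    exact ⟨⟨(g', t'), hg', ht', fun x hx => ⟨(hb x hx).1.trans (hb' x hx).1, (hb' x hx).2.2⟩⟩,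
      htt, fun x hx => ⟨(hb' x hx).1, (hb' x hx).2.1⟩, hab⟩
  choose next hnext using step
  let s : ℕ → State := fun n => Nat.rec
    ⟨(base, 1), hbase, one_pos, fun x hx => ⟨le_rfl, hlt x hx⟩⟩ (fun n s => next n s) n
  have hs : ∀ n, s (n + 1) = next n (s n) := fun n => rfl
  have hmono : ∀ x ∈ Ioo (0 : ℝ) 1, Monotone fun n => (s n).1.1 x := fun x hx =>
    monotone_nat_of_le_succ fun n => by rw [hs]; exact ((hnext n (s n)).2.1 x hx).1
  have hanti : ∀ x ∈ Ioo (0 : ℝ) 1, Antitone fun n => (s n).1.1 x + (s n).1.2 := fun x hx =>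
    antitone_nat_of_succ_le fun n => by
      rw [hs]
      linarith [((hnext n (s n)).2.1 x hx).2, (hnext n (s n)).1]
  have hbdd : ∀ x ∈ Ioo (0 : ℝ) 1, BddAbove (range fun n => (s n).1.1 x) := fun x hx =>
    ⟨cap x, by rintro _ ⟨n, rfl⟩; exact ((s n).2.2.2 x hx).2.le⟩
  let g : ℝ → ℝ := fun x => ⨆ n, (s n).1.1 x
  have hsg : ∀ n, ∀ x ∈ Ioo (0 : ℝ) 1, (s n).1.1 x ≤ g x := fun n x hx => le_ciSup (hbdd x hx) n
  -- The function plus its budget decreases along the stages, so the limit exceeds stage `n` by at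
  -- most the budget left there.
  have hgs : ∀ n, ∀ x ∈ Ioo (0 : ℝ) 1, g x ≤ (s n).1.1 x + (s n).1.2 := fun n x hx => by
    refine ciSup_le fun m => ?_
    have h1 := hanti x hx (le_max_right m n)
    have h2 := hmono x hx (le_max_left m n)
    have h3 := (s (max m n)).2.2.1
    simp only at h1 h2
    linarith
  refine ⟨g, ⟨?_, ?_⟩, fun x hx => ⟨hsg 0 x hx, ciSup_le fun n => ((s n).2.2.2 x hx).2.le⟩, ?_⟩
  · intro x hx y hy hxy
    have h1 : 0 < 1 - y := by linarith [hy.2]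
    have h2 : 0 < 1 - x := by linarith [hx.2]
    have : g y ≤ (1 - x) * g x / (1 - y) := ciSup_le fun n => by
      rw [le_div_iff₀ h1]
      have h3 : (1 - y) * (s n).1.1 y ≤ (1 - x) * (s n).1.1 x := (s n).2.1.1 hx hy hxy
      have h4 := mul_le_mul_of_nonneg_left (hsg n x hx) h2.le
      linarith
    rw [le_div_iff₀ h1] at this
    simp only
    linarith
  · intro x hx y hy hxy
    have : g x ≤ g y + σ * y ^ 2 - σ * x ^ 2 := ciSup_le fun n => by
      have h3 : (s n).1.1 x + σ * x ^ 2 ≤ (s n).1.1 y + σ * y ^ 2 := (s n).2.1.2 hx hy hxy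
      linarith [hsg n y hy]
    simp only
    linarith
  · intro U hU ⟨c, hc⟩ hU1
    obtain ⟨e, he, hball⟩ := Metric.isOpen_iff.1 hU c hc
    obtain ⟨i, hi⟩ := (TopologicalSpace.denseRange_denseSeq (Ioo (0 : ℝ) 1)).exists_dist_lt
      ⟨c, hU1 hc⟩ (half_pos he)
    obtain ⟨j, hj⟩ := exists_nat_one_div_lt (half_pos he)
    have hpn : p (Nat.pair i j) = (TopologicalSpace.denseSeq (Ioo (0 : ℝ) 1) i : ℝ) := by
      simp only [p, Nat.unpair_pair]
    have hrn : r (Nat.pair i j) < e / 2 := by simpa only [r, Nat.unpair_pair] using hj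
    have hd : |c - p (Nat.pair i j)| < e / 2 := by
      rw [hpn, ← Real.dist_eq]
      exact hi
    generalize Nat.pair i j = n at hpn hrn hd
    obtain ⟨-, -, a, ha, b, hb, h1, h2, h3, h4, h5, h6⟩ := hnext n (s n)
    rw [← hs] at h5 h6
    rw [abs_lt] at hd
    have haU : a ∈ U := hball (by rw [mem_ball, Real.dist_eq, abs_lt]; constructor <;> linarith)
    have hbU : b ∈ U := hball (by rw [mem_ball, Real.dist_eq, abs_lt]; constructor <;> linarith)
    have hpU : p n ∈ U := hball (by rw [mem_ball, Real.dist_eq, abs_lt]; constructor <;> linarith)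
    have hga : g a < g (p n) := by linarith [hgs (n + 1) a ha, hsg (n + 1) _ (hp n)]
    have hgb : g b < g (p n) := by linarith [hgs (n + 1) b hb, hsg (n + 1) _ (hp n)]
    exact ⟨fun h => (h hpU hbU h3.le).not_gt hgb, fun h => (h haU hpU h2.le).not_gt hga⟩

/-! ### Oscillating members of the class 𝒜 close to a given function -/

/-- The points `θ` and `ρ = l / θ` have product `l`, so at least one is `≥ √l`. There the growth of
`base` outweighs the width of the strip (`far`). If the other lies below `√l`, the slope bound
limits the loss (`near`); because that bound is quadratic, the loss carries a factor `√l` and the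
gain absorbs it. -/
theorem SlopeBounded.classA_of_increasing {d : ℕ} {η : ℝ} {base g : ℝ → ℝ} (hη : 0 ≤ η)
    (hg : SlopeBounded (η / 4) g) (hgd : ∀ x ∈ Ioo (0 : ℝ) 1, g x ∈ Icc (0 : ℝ) d)
    (hbase : ∀ x ∈ Ioo (0 : ℝ) 1, ∀ y ∈ Ioo (0 : ℝ) 1, x ≤ y → η * (y - x) ≤ base y - base x)
    (hclose : ∀ x ∈ Ioo (0 : ℝ) 1, base x ≤ g x ∧ g x ≤ base x + η / 4 * (x * (1 - x))) :
    ClassA d g := by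
  refine ⟨hgd, fun l θ hl hlθ hθ => ?_⟩
  have hlI : l ∈ Ioo (0 : ℝ) 1 := ⟨hl, hlθ.trans hθ⟩
  have hθ0 : 0 < θ := hl.trans hlθ
  have hθI : θ ∈ Ioo (0 : ℝ) 1 := ⟨hθ0, hθ⟩
  refine ⟨sub_nonneg.2 (hg.1 hlI hθI hlθ.le), ?_⟩
  set ρ := l / θ with hρ
  have hρθ : ρ * θ = l := by rw [hρ]; field_simp
  have hρ0 : 0 < ρ := by positivity
  have hρ1 : ρ < 1 := (div_lt_one hθ0).2 hlθ
  have hρI : ρ ∈ Ioo (0 : ℝ) 1 := ⟨hρ0, hρ1⟩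
  set q := √l with hq
  have hq0 : 0 < q := Real.sqrt_pos.2 hl
  have hqq : q * q = l := Real.mul_self_sqrt hl.le
  have hq1 : q < 1 := by nlinarith [hlI.2]
  have far : ∀ u ∈ Ioo (0 : ℝ) 1, q ≤ u → η / 2 * (u - l) ≤ g u - g l := by
    intro u hu hqu
    have hlu : l ≤ u := by nlinarith
    have h1 := hbase l hlI u hu hlu
    have h2 := (hclose u hu).1
    have h3 := (hclose l hlI).2
    have h4 : l * (1 - l) ≤ 2 * (u - l) := by
      have : l * (1 - l) ≤ 2 * (q - l) := by
        have : 0 ≤ q * (1 - q) * (2 - q * (1 + q)) := by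
          have h5 : 0 ≤ 1 - q := by linarith
          have h6 : 0 ≤ 2 - q * (1 + q) := by nlinarith
          positivity
        rw [← hqq]
        nlinarith
      linarith
    have h5 : η / 4 * (l * (1 - l)) ≤ η / 4 * (2 * (u - l)) :=
      mul_le_mul_of_nonneg_left h4 (by linarith)
    linarith
  have near : ∀ u ∈ Ioo (0 : ℝ) 1, l ≤ u → u ≤ q → -(η / 2 * q * (u - l)) ≤ g u - g l := by
    intro u hu hlu huq
    have h1 : g l + η / 4 * l ^ 2 ≤ g u + η / 4 * u ^ 2 := hg.2 hlI hu hlu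
    have h2 : 0 ≤ η / 4 * ((2 * q - u - l) * (u - l)) := by
      have : 0 ≤ 2 * q - u - l := by linarith
      have : 0 ≤ u - l := by linarith
      positivity
    nlinarith
  have hlρ : l ≤ ρ := by nlinarith
  -- after cancelling `θ - l`, the inequality compares the increments of `g` from `l`
  suffices h : 0 ≤ (1 - θ) * (g θ - g l) + (θ - l) * (g ρ - g l) by nlinarith
  have hθl : 0 < θ - l := by linarith
  have h1θ : 0 < 1 - θ := by linarith
  have eρ : ρ - l = ρ * (1 - θ) := by rw [← hρθ]; ring
  rcases le_total q θ with hqθ | hqθ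
  · have h1 := mul_le_mul_of_nonneg_left (far θ hθI hqθ) h1θ.le
    rcases le_total q ρ with hqρ | hqρ
    · have h2 := mul_le_mul_of_nonneg_left (far ρ hρI hqρ) hθl.le
      have h3 : 0 ≤ (1 - θ) * (η / 2 * (θ - l)) := by positivity
      have h4 : 0 ≤ (θ - l) * (η / 2 * (ρ - l)) := by rw [eρ]; positivity
      linarith
    · have h2 := mul_le_mul_of_nonneg_left (near ρ hρI hlρ hqρ) hθl.le
      rw [eρ] at h2
      have h3 : 0 ≤ (1 - θ) * (θ - l) * (η / 2) * (1 - q * ρ) := by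
        have : 0 ≤ 1 - q * ρ := by nlinarith
        positivity
      linarith
  · have hqρ : q ≤ ρ := by
      by_contra! hlt
      nlinarith
    have h1 := mul_le_mul_of_nonneg_left (near θ hθI hlθ.le hqθ) h1θ.le
    have h2 := mul_le_mul_of_nonneg_left (far ρ hρI hqρ) hθl.le
    rw [eρ] at h2
    have h3 : 0 ≤ (1 - θ) * (θ - l) * (η / 2) * (ρ - q) := by
      have : 0 ≤ ρ - q := by linarith
      positivity
    linarith

theorem IncreasingWithDecreasingRate.exists_classA_near {d : ℕ} (hd : 1 ≤ d) {φ : ℝ → ℝ}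
    (hφ : ∀ θ ∈ Ioo (0 : ℝ) 1, φ θ ∈ Icc (0 : ℝ) d) (h : IncreasingWithDecreasingRate φ)
    {ε : ℝ} (hε : 0 < ε) :
    ∃ g : ℝ → ℝ, ClassA d g ∧ NonMonotoneOnEveryOpen g ∧
      ∀ θ ∈ Ioo (0 : ℝ) 1, |g θ - φ θ| ≤ ε := by
  have hd' : (1 : ℝ) ≤ d := by exact_mod_cast hd
  -- Shrinking `φ` by `1 - τ` makes room below `d` for the added terms, which total at most `4 * η =
  -- τ`. The factor `2 + x` is chosen because both it and `-(1 - x) * (2 + x)` increase with slope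
  -- at least `1`.
  set τ := min (1 / 2) (ε / (2 * d)) with hτ
  have hτ0 : 0 < τ := lt_min (by norm_num) (by positivity)
  have hτ1 : τ ≤ 1 / 2 := min_le_left _ _
  have hτε : τ * (2 * d) ≤ ε := by
    have : τ ≤ ε / (2 * d) := min_le_right _ _
    rwa [le_div_iff₀ (by positivity)] at this
  set η := τ / 4 with hη
  have hη0 : 0 < η := by positivity
  set base : ℝ → ℝ := fun x => (1 - τ) * φ x + η * (2 + x) with hbase
  have hinc : ∀ x ∈ Ioo (0 : ℝ) 1, ∀ y ∈ Ioo (0 : ℝ) 1, x ≤ y →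
      η * (y - x) ≤ base y - base x := by
    intro x hx y hy hxy
    have := mul_le_mul_of_nonneg_left (h.1 hx hy hxy) (show 0 ≤ 1 - τ by linarith)
    simp only [hbase]
    linarith
  have hdec : ∀ x ∈ Ioo (0 : ℝ) 1, ∀ y ∈ Ioo (0 : ℝ) 1, x ≤ y →
      (1 - y) * base y + η * (y - x) ≤ (1 - x) * base x := by
    intro x hx y hy hxy
    have h1 : (1 - y) * φ y ≤ (1 - x) * φ x := h.2 hx hy hxy
    have h2 := mul_le_mul_of_nonneg_left h1 (show 0 ≤ 1 - τ by linarith)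
    have h3 : 0 ≤ η * ((y - x) * (y + x)) := by
      have := hx.1; have := hy.1
      have : 0 ≤ y - x := by linarith
      positivity
    simp only [hbase]
    nlinarith
  have sq_mono : ∀ x ∈ Ioo (0 : ℝ) 1, ∀ y ∈ Ioo (0 : ℝ) 1, x ≤ y →
      η / 4 * x ^ 2 ≤ η / 4 * y ^ 2 := fun x hx y hy hxy =>
    mul_le_mul_of_nonneg_left (pow_le_pow_left₀ hx.1.le hxy 2) (by positivity)
  have hsb : SlopeBounded (η / 4) base := by
    constructor
    · intro x hx y hy hxy
      simp only
      nlinarith [hdec x hx y hy hxy]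
    · intro x hx y hy hxy
      simp only
      nlinarith [hinc x hx y hy hxy, sq_mono x hx y hy hxy]
  set cap : ℝ → ℝ := fun x => base x + η / 4 * (x * (1 - x)) with hcap
  have hsc : SlopeBounded (η / 4) cap := by
    constructor
    · intro x hx y hy hxy
      have h1 : 0 ≤ (y - x) * η * (1 - (1 - (x + y) * 2 + (x ^ 2 + x * y + y ^ 2)) / 4) := by
        have h2 : 0 ≤ y - x := by linarith
        have h3 : 0 ≤ 1 - (1 - (x + y) * 2 + (x ^ 2 + x * y + y ^ 2)) / 4 := by
          nlinarith [hx.1, hx.2, hy.1, hy.2, mul_pos hx.1 hy.1]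
        positivity
      simp only [hcap]
      nlinarith [hdec x hx y hy hxy]
    · intro x hx y hy hxy
      have h1 : 0 ≤ (y - x) * η * (1 + (1 - (x + y)) / 4) := by
        have h2 : 0 ≤ y - x := by linarith
        have h3 : 0 ≤ 1 + (1 - (x + y)) / 4 := by linarith [hx.2, hy.2]
        positivity
      simp only [hcap]
      nlinarith [hinc x hx y hy hxy, sq_mono x hx y hy hxy]
  have hge : ∀ x ∈ Ioo (0 : ℝ) 1, η / 4 ≤ base x := by
    intro x hx
    have h1 : 0 ≤ (1 - τ) * φ x := mul_nonneg (by linarith) (hφ x hx).1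
    have h2 : 0 ≤ η * x := mul_nonneg hη0.le hx.1.le
    simp only [hbase]
    linarith
  obtain ⟨g, hg, hgb, hgn⟩ := exists_nonMonotoneOnEveryOpen (by positivity : 0 < η / 4) hsb hsc
    (fun x hx => by
      have : 0 < η / 4 * (x * (1 - x)) :=
        mul_pos (by positivity) (mul_pos hx.1 (by linarith [hx.2]))
      simp only [hcap]
      linarith) hge
  have hup : ∀ x ∈ Ioo (0 : ℝ) 1, g x ≤ (1 - τ) * φ x + τ := by
    intro x hx
    have h1 : η * (x + (x * (1 - x)) / 4) ≤ η * 2 :=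
      mul_le_mul_of_nonneg_left (by nlinarith [hx.1, hx.2]) hη0.le
    have h2 := (hgb x hx).2
    simp only [hcap, hbase] at h2
    linarith
  refine ⟨g, hg.classA_of_increasing hη0.le (fun x hx => ⟨?_, ?_⟩) hinc hgb, hgn, ?_⟩
  · linarith [hge x hx, (hgb x hx).1]
  · have := mul_le_mul_of_nonneg_left (hφ x hx).2 (show 0 ≤ 1 - τ by linarith)
    nlinarith [hup x hx]
  · intro x hx
    have h1 := mul_le_mul_of_nonneg_left (hφ x hx).2 hτ0.le
    have h2 := mul_nonneg hτ0.le (hφ x hx).1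
    have h3 := (hgb x hx).1
    have h4 := mul_nonneg hη0.le hx.1.le
    have h5 : τ ≤ τ * d := le_mul_of_one_le_right hτ0.le hd'
    simp only [hbase] at h3
    rw [abs_le]
    constructor <;> nlinarith [hup x hx]

/-! ### Digit positions with prescribed counting function -/

theorem ClassA.div_natCast {d : ℕ} (hd : 1 ≤ d) {g : ℝ → ℝ} (hg : ClassA d g) :
    ClassA 1 fun θ => g θ / d := by
  have hd0 : (0 : ℝ) < d := by exact_mod_cast hd
  refine ⟨fun θ hθ => ⟨div_nonneg (hg.1 θ hθ).1 hd0.le, ?_⟩, fun l θ hl hlθ hθ => ?_⟩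
  · rw [Nat.cast_one, div_le_one hd0]
    exact (hg.1 θ hθ).2
  · obtain ⟨h1, h2⟩ := hg.2 l θ hl hlθ hθ
    simp only [mul_div_assoc', ← sub_div]
    exact ⟨div_nonneg h1 hd0.le, div_le_div_of_nonneg_right h2 hd0.le⟩

/-- The function `(1 - t) ψ t`, continued by zero beyond `1`. -/
noncomputable def rate (ψ : ℝ → ℝ) (t : ℝ) : ℝ :=
  if t < 1 then (1 - t) * ψ t else 0

section rate
variable {ψ : ℝ → ℝ} {s t θ c : ℝ}

theorem rate_of_lt (ht : t < 1) : rate ψ t = (1 - t) * ψ t := if_pos ht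

theorem rate_of_le (ht : 1 ≤ t) : rate ψ t = 0 := if_neg ht.not_gt

theorem rate_nonneg (hψ : ClassA 1 ψ) (ht : 0 < t) : 0 ≤ rate ψ t := by
  rcases lt_or_ge t 1 with h | h
  · rw [rate_of_lt h]
    exact mul_nonneg (by linarith) (hψ.1 t ⟨ht, h⟩).1
  · rw [rate_of_le h]

theorem rate_antitone (hψ : ClassA 1 ψ) (hs : 0 < s) (hst : s ≤ t) : rate ψ t ≤ rate ψ s := by
  rcases lt_or_ge t 1 with h | h
  · rcases hst.eq_or_lt with rfl | hlt
    · exact le_rfl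
    · rw [rate_of_lt h, rate_of_lt (hlt.trans h)]
      linarith [(hψ.2 s t hs hlt h).1]
  · rw [rate_of_le h]
    exact rate_nonneg hψ hs

/-- The upper 𝒜 inequality combined with `ψ ≤ 1`. Slope at most one is what lets the counting
function be realised by integer positions. -/
theorem rate_sub_le (hψ : ClassA 1 ψ) (hs : 0 < s) (hst : s ≤ t) :
    rate ψ s - rate ψ t ≤ t - s := by
  rcases hst.eq_or_lt with rfl | hlt
  · simp
  have ht := hs.trans hlt
  have hle : ∀ x ∈ Ioo (0 : ℝ) 1, ψ x ≤ 1 := fun x hx => by simpa using (hψ.1 x hx).2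
  rcases lt_or_ge t 1 with h | h
  · rw [rate_of_lt h, rate_of_lt (hlt.trans h)]
    have h1 := (hψ.2 s t hs hlt h).2
    have h2 := hle (s / t) ⟨by positivity, (div_lt_one ht).2 hlt⟩
    nlinarith
  · rw [rate_of_le h]
    rcases lt_or_ge s 1 with h' | h'
    · rw [rate_of_lt h']
      nlinarith [hle s ⟨hs, h'⟩]
    · rw [rate_of_le h']
      linarith

/-- The upper 𝒜 inequality for the pair `t < t / θ`, whose quotient is `θ`. Once `t / θ ≥ 1`,
monotonicity of `rate` replaces it. -/
theorem rate_sub_rate_div_le (hψ : ClassA 1 ψ) (hθ : θ ∈ Ioo (0 : ℝ) 1) (ht : 0 < t) :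
    rate ψ t - rate ψ (t / θ) ≤ (t / θ - t) * ψ θ := by
  obtain ⟨hθ0, hθ1⟩ := hθ
  have htt : t < t / θ := (lt_div_iff₀ hθ0).2 (by nlinarith)
  have hψ0 := (hψ.1 θ ⟨hθ0, hθ1⟩).1
  rcases lt_or_ge (t / θ) 1 with h | h
  · rw [rate_of_lt h, rate_of_lt (htt.trans h)]
    have h1 := (hψ.2 t (t / θ) ht htt h).2
    rwa [div_div_cancel₀ ht.ne'] at h1
  · rw [rate_of_le h, sub_zero]
    have hθt : θ ≤ t := (one_le_div hθ0).1 h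
    have h1 := rate_antitone hψ hθ0 hθt
    rw [rate_of_lt hθ1] at h1
    have h2 : t / θ - t = t / θ * (1 - θ) := by field_simp
    rw [h2]
    have h3 : 0 ≤ (1 - θ) * ψ θ := mul_nonneg (by linarith) hψ0
    nlinarith

theorem rate_max_sub_le (hψ : ClassA 1 ψ) (hs : 0 < s) (hst : s ≤ t) :
    rate ψ (max c s) - rate ψ (max c t) ≤ rate ψ s - rate ψ t := by
  rcases le_total t c with htc | htc
  · rw [max_eq_left htc, max_eq_left (hst.trans htc), sub_self]
    linarith [rate_antitone hψ hs hst]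
  · rw [max_eq_right htc]
    linarith [rate_antitone hψ hs (le_max_right c s)]

end rate

/-- The right end point of the `k`-th block of scales. -/
def blockEnd (k : ℕ) : ℕ := (k + 1).factorial ^ 3

/-- The growth profile of the `k`-th block of scales: constant outside the block, and matching
`rate ψ` after rescaling inside. -/
noncomputable def profile (ψ : ℝ → ℝ) (k : ℕ) (x : ℝ) : ℝ :=
  blockEnd k * (rate ψ (1 / (k + 1)) - rate ψ (max (1 / (k + 1)) (x / blockEnd k)))

theorem blockEnd_pos (k : ℕ) : 0 < blockEnd k := pow_pos (Nat.factorial_pos _) 3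

theorem blockEnd_mono : Monotone blockEnd := fun _ _ h =>
  Nat.pow_le_pow_left (Nat.factorial_le (Nat.succ_le_succ h)) 3

theorem le_blockEnd (k : ℕ) : k ≤ blockEnd k :=
  (Nat.le_succ k).trans ((Nat.self_le_factorial _).trans (Nat.le_self_pow three_ne_zero _))

/-- The cube in `blockEnd` pays for this: one factor `k + 1` moves from the end of block `k` to its
start, and two remain to separate it from all earlier blocks. -/
theorem sq_mul_blockEnd_le {j k : ℕ} (h : j < k) :
    ((k : ℝ) + 1) ^ 2 * blockEnd j ≤ 1 / (k + 1) * blockEnd k := by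
  have h1 : (blockEnd j : ℝ) ≤ (k.factorial : ℝ) ^ 3 := by
    exact_mod_cast Nat.pow_le_pow_left (Nat.factorial_le h) 3
  have h2 : (1 : ℝ) / (k + 1) * blockEnd k = (k + 1) ^ 2 * (k.factorial : ℝ) ^ 3 := by
    have : (k : ℝ) + 1 ≠ 0 := by positivity
    rw [blockEnd, Nat.factorial_succ]
    push_cast
    field_simp
  rw [h2]
  exact mul_le_mul_of_nonneg_left h1 (by positivity)

section profile
variable {ψ : ℝ → ℝ} {k : ℕ} {x y θ : ℝ}

theorem profile_mono (hψ : ClassA 1 ψ) (h : x ≤ y) : profile ψ k x ≤ profile ψ k y := by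
  have hN : (0 : ℝ) < blockEnd k := by exact_mod_cast blockEnd_pos k
  refine mul_le_mul_of_nonneg_left (sub_le_sub_left (rate_antitone hψ ?_ ?_) _) hN.le
  · exact lt_max_of_lt_left (by positivity)
  · exact max_le_max le_rfl (div_le_div_of_nonneg_right h hN.le)

theorem profile_sub_le (hψ : ClassA 1 ψ) (h : x ≤ y) :
    profile ψ k y - profile ψ k x ≤ y - x := by
  have hN : (0 : ℝ) < blockEnd k := by exact_mod_cast blockEnd_pos k
  have hxy := div_le_div_of_nonneg_right h hN.le
  set c : ℝ := 1 / (k + 1) with hc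
  have hc0 : 0 < c := by positivity
  have h1 := rate_sub_le hψ (show 0 < max c (x / blockEnd k) from lt_max_of_lt_left hc0)
    (max_le_max (le_refl c) hxy)
  have h2 : max c (y / blockEnd k) - max c (x / blockEnd k) ≤ y / blockEnd k - x / blockEnd k := by
    rcases le_total c (x / blockEnd k) with h3 | h3
    · rw [max_eq_right h3, max_eq_right (h3.trans hxy)]
    · rw [max_eq_left h3, sub_le_iff_le_add]
      refine max_le (by linarith) (by linarith)
  have h3 := mul_le_mul_of_nonneg_left (h1.trans h2) hN.le
  have h4 : (blockEnd k : ℝ) * (y / blockEnd k - x / blockEnd k) = y - x := by field_simp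
  simp only [profile]
  linarith

theorem profile_div_sub_le (hψ : ClassA 1 ψ) (hθ : θ ∈ Ioo (0 : ℝ) 1) (hx : 0 < x) :
    profile ψ k (x / θ) - profile ψ k x ≤ ψ θ * (x / θ - x) := by
  have hN : (0 : ℝ) < blockEnd k := by exact_mod_cast blockEnd_pos k
  have hθ0 := hθ.1
  have hxN : 0 < x / blockEnd k := by positivity
  have h0 : x / blockEnd k ≤ x / blockEnd k / θ := le_div_self hxN.le hθ.1 hθ.2.le
  have h1 := (rate_max_sub_le (c := 1 / (k + 1)) hψ hxN h0).trans
    (rate_sub_rate_div_le hψ hθ hxN)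
  have h2 := mul_le_mul_of_nonneg_left h1 hN.le
  have h3 : (blockEnd k : ℝ) * ((x / blockEnd k / θ - x / blockEnd k) * ψ θ)
      = ψ θ * (x / θ - x) := by field_simp
  rw [h3, div_right_comm] at h2
  simp only [profile]
  linarith

theorem profile_eq_zero (hx : x ≤ 1 / (k + 1) * blockEnd k) : profile ψ k x = 0 := by
  have hN : (0 : ℝ) < blockEnd k := by exact_mod_cast blockEnd_pos k
  rw [profile, max_eq_left ((div_le_iff₀ hN).2 hx), sub_self, mul_zero]

theorem profile_of_blockEnd_le (hx : blockEnd k ≤ x) :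
    profile ψ k x = blockEnd k * rate ψ (1 / (k + 1)) := by
  have hN : (0 : ℝ) < blockEnd k := by exact_mod_cast blockEnd_pos k
  rw [profile, rate_of_le (le_max_of_le_right ((one_le_div hN).2 hx)), sub_zero]

theorem profile_blockEnd_sub (hθ : θ ∈ Ioo (0 : ℝ) 1) (hk : 1 / ((k : ℝ) + 1) ≤ θ) :
    profile ψ k (blockEnd k) - profile ψ k (θ * blockEnd k)
      = ψ θ * (blockEnd k - θ * blockEnd k) := by
  have hN : (blockEnd k : ℝ) ≠ 0 := by exact_mod_cast (blockEnd_pos k).ne'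
  rw [profile_of_blockEnd_le le_rfl, profile, mul_div_cancel_right₀ _ hN, max_eq_right hk,
    rate_of_lt hθ.2]
  ring

end profile

/-- The positions at which the integer part of the `k`-th profile jumps. -/
def jumpSet (ψ : ℝ → ℝ) (k : ℕ) : Set ℕ :=
  {n | ⌊profile ψ k n⌋ < ⌊profile ψ k (n + 1)⌋}

theorem mem_jumpSet_bounds {ψ : ℝ → ℝ} {k n : ℕ} (h : n ∈ jumpSet ψ k) :
    1 / ((k : ℝ) + 1) * blockEnd k < n + 1 ∧ n < blockEnd k := by
  have h' : ⌊profile ψ k n⌋ < ⌊profile ψ k (n + 1)⌋ := h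
  constructor
  · by_contra! hle
    rw [profile_eq_zero hle, profile_eq_zero (by linarith)] at h'
    exact lt_irrefl _ h'
  · by_contra! hle
    have hle' : (blockEnd k : ℝ) ≤ n := by exact_mod_cast hle
    rw [profile_of_blockEnd_le hle', profile_of_blockEnd_le (by linarith)] at h'
    exact lt_irrefl _ h'

open Classical in
theorem card_filter_lt_succ {a : ℕ → ℤ} (h1 : ∀ n, a n ≤ a (n + 1)) (h2 : ∀ n, a (n + 1) ≤ a n + 1)
    {m n : ℕ} (hmn : m ≤ n) :
    (((Finset.Ico m n).filter fun i => a i < a (i + 1)).card : ℤ) = a n - a m := by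
  induction n, hmn using Nat.le_induction with
  | base => simp
  | succ n hmn ih =>
    rw [← Finset.insert_Ico_right_eq_Ico_add_one hmn, Finset.filter_insert]
    have := h1 n
    have := h2 n
    split_ifs with h
    · rw [Finset.card_insert_of_notMem (by simp)]
      push_cast
      omega
    · omega

-- The integer part of the profile rises by 0 or 1 at each integer step, so the count telescopes.
open Classical in
theorem card_filter_jumpSet {ψ : ℝ → ℝ} (hψ : ClassA 1 ψ) (k : ℕ) {m n : ℕ} (hmn : m ≤ n) :
    (((Finset.Ico m n).filter (· ∈ jumpSet ψ k)).card : ℤ)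
      = ⌊profile ψ k n⌋ - ⌊profile ψ k m⌋ := by
  rw [← card_filter_lt_succ (a := fun n : ℕ => ⌊profile ψ k n⌋) _ _ hmn]
  · congr! 4 with i
    simp [jumpSet]
  · intro n
    exact Int.floor_mono (profile_mono hψ (by simp))
  · intro n
    rw [← Int.floor_add_one]
    refine Int.floor_mono ?_
    have := profile_sub_le (k := k) hψ (show (n : ℝ) ≤ (n + 1 : ℕ) by simp)
    push_cast at this ⊢
    linarith

open Classical in
theorem card_filter_jumpSet_bounds {ψ : ℝ → ℝ} (hψ : ClassA 1 ψ) (k : ℕ) {m n : ℕ} (hmn : m ≤ n) :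
    (((Finset.Ico m n).filter (· ∈ jumpSet ψ k)).card : ℝ) ≤ profile ψ k n - profile ψ k m + 1 ∧
    profile ψ k n - profile ψ k m - 1 ≤ ((Finset.Ico m n).filter (· ∈ jumpSet ψ k)).card := by
  have h : (((Finset.Ico m n).filter (· ∈ jumpSet ψ k)).card : ℝ)
      = (⌊profile ψ k n⌋ : ℝ) - ⌊profile ψ k m⌋ := by
    exact_mod_cast card_filter_jumpSet hψ k hmn
  rw [h]
  constructor <;> linarith [Int.floor_le (profile ψ k n), Int.lt_floor_add_one (profile ψ k n),
    Int.floor_le (profile ψ k m), Int.lt_floor_add_one (profile ψ k m)]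

/-- All positions at which the integer part of some profile jumps. -/
def digitSet (ψ : ℝ → ℝ) : Set ℕ := ⋃ k, jumpSet ψ k

-- Blocks are so far apart that a window of bounded ratio, unless it starts early, meets at most one
-- of them; there the bound for a single profile applies. The slack `D` will absorb the dimension.
open Classical in
theorem card_filter_digitSet_le {ψ : ℝ → ℝ} (hψ : ClassA 1 ψ) {θ : ℝ} (hθ : θ ∈ Ioo (0 : ℝ) 1)
    (D : ℕ) : ∃ C : ℝ, ∀ X : ℝ, 0 ≤ X →
      (((Finset.Ico ⌊X⌋₊ (⌈X / θ⌉₊ + D)).filter (· ∈ digitSet ψ)).card : ℝ)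
        ≤ ψ θ * (X / θ - X) + C := by
  have hθ0 := hθ.1
  have hψ0 := (hψ.1 θ hθ).1
  set R : ℝ := 1 / θ + 1 + D with hR
  have hθ1 : 0 < 1 / θ := by positivity
  have hR0 : 1 ≤ R := by
    have : (0 : ℝ) ≤ D := by positivity
    linarith
  set K : ℕ := ⌈R⌉₊
  have hRK : R ≤ K := Nat.le_ceil _
  -- The first term counts all positions of a window starting before `blockEnd K`. The second
  -- collects rounding: one for the integer parts, one for `⌊X⌋₊`, and `D + 1` at the upper end.
  refine ⟨R * (blockEnd K + 1) + (D + 3), fun X hX => ?_⟩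
  set m := ⌊X⌋₊
  set n := ⌈X / θ⌉₊ + D with hn
  have hmX : (m : ℝ) ≤ X := Nat.floor_le hX
  have hXm : X < m + 1 := Nat.lt_floor_add_one X
  have hXθ : X ≤ X / θ := le_div_self hX hθ.1 hθ.2.le
  have hn1 : X / θ ≤ n - D := by
    rw [hn]; push_cast; linarith [Nat.le_ceil (X / θ)]
  have hn2 : (n : ℝ) ≤ X / θ + 1 + D := by
    rw [hn]; push_cast; linarith [Nat.ceil_lt_add_one (show 0 ≤ X / θ by positivity)]
  have hmn : m ≤ n := by
    have : (0 : ℝ) ≤ D := by positivity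
    have : (m : ℝ) ≤ n := by linarith
    exact_mod_cast this
  have hnR : (n : ℝ) ≤ R * (m + 1) := by
    have h1 : X / θ ≤ 1 / θ * (m + 1) := by
      rw [div_eq_mul_one_div, mul_comm]
      exact mul_le_mul_of_nonneg_left hXm.le hθ1.le
    have h2 : (0 : ℝ) ≤ (1 + D) * m := by positivity
    rw [hR]
    linarith
  have hpos : 0 ≤ ψ θ * (X / θ - X) := mul_nonneg hψ0 (by linarith)
  have hRpos : 0 ≤ R * (blockEnd K + 1) := by positivity
  rcases lt_or_ge m (blockEnd K) with hsmall | hlarge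
  · have h1 : ((Finset.Ico m n).filter (· ∈ digitSet ψ)).card ≤ n :=
      (Finset.card_filter_le _ _).trans (by simp)
    have h1' : (((Finset.Ico m n).filter (· ∈ digitSet ψ)).card : ℝ) ≤ n := by exact_mod_cast h1
    have h2 : (m : ℝ) + 1 ≤ blockEnd K + 1 := by
      have : (m : ℝ) < blockEnd K := by exact_mod_cast hsmall
      linarith
    have h3 := mul_le_mul_of_nonneg_left h2 (show 0 ≤ R by linarith)
    have : (0 : ℝ) ≤ D := by positivity
    linarith
  · have sep : ∀ j k a b : ℕ, j < k → a ∈ jumpSet ψ j → b ∈ jumpSet ψ k → m ≤ a → b < n →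
        False := by
      intro j k a b hjk ha hb hma hbn
      have h1 := (mem_jumpSet_bounds hb).1
      have h2 := (mem_jumpSet_bounds ha).2
      have h3 := sq_mul_blockEnd_le hjk
      have h4 : (b : ℝ) + 1 ≤ n := by exact_mod_cast hbn
      have h5 : (m : ℝ) + 1 ≤ blockEnd j := by exact_mod_cast hma.trans_lt h2
      have hj : (0 : ℝ) < blockEnd j := by exact_mod_cast blockEnd_pos j
      have h6 : ((k : ℝ) + 1) ^ 2 * blockEnd j < R * blockEnd j := by
        have := mul_le_mul_of_nonneg_left h5 (show 0 ≤ R by linarith)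
        linarith
      have h7 : ((k : ℝ) + 1) ^ 2 < R := lt_of_mul_lt_mul_right h6 hj.le
      have h8 : (k : ℝ) < K := by
        have : (0 : ℝ) ≤ k := by positivity
        nlinarith
      have h9 : k < K := by exact_mod_cast h8
      have h10 := blockEnd_mono (hjk.trans h9).le
      omega
    rcases ((Finset.Ico m n).filter (· ∈ digitSet ψ)).eq_empty_or_nonempty with he | ⟨a, ha⟩
    · rw [he, Finset.card_empty, Nat.cast_zero]
      have : (0 : ℝ) ≤ D := by positivity
      linarith
    · rw [Finset.mem_filter, Finset.mem_Ico, digitSet, mem_iUnion] at ha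
      obtain ⟨⟨ha1, ha2⟩, k, hk⟩ := ha
      have hsub : (Finset.Ico m n).filter (· ∈ digitSet ψ)
          ⊆ (Finset.Ico m n).filter (· ∈ jumpSet ψ k) := by
        intro b hb
        rw [Finset.mem_filter, Finset.mem_Ico, digitSet, mem_iUnion] at hb
        obtain ⟨⟨hb1, hb2⟩, j, hj⟩ := hb
        rw [Finset.mem_filter, Finset.mem_Ico]
        refine ⟨⟨hb1, hb2⟩, ?_⟩
        rcases lt_trichotomy j k with h | h | h
        · exact (sep j k b a h hj hk hb1 ha2).elim
        · exact h ▸ hj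
        · exact (sep k j a b h hk hj ha1 hb2).elim
      have hX0 : 0 < X := by
        have : (1 : ℝ) ≤ m := by exact_mod_cast (blockEnd_pos K).trans_le hlarge
        linarith
      have hD : (0 : ℝ) ≤ D := by positivity
      have h1 : (((Finset.Ico m n).filter (· ∈ digitSet ψ)).card : ℝ)
          ≤ ((Finset.Ico m n).filter (· ∈ jumpSet ψ k)).card := by
        exact_mod_cast Finset.card_le_card hsub
      have h2 := (card_filter_jumpSet_bounds hψ k hmn).1
      have h3 := profile_div_sub_le (k := k) hψ hθ hX0
      have h4 := profile_sub_le (k := k) hψ (show X / θ ≤ n by linarith)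
      have h5 := profile_sub_le (k := k) hψ hmX
      linarith

-- The windows ending at `blockEnd k` are extremal, as soon as the cutoff `1 / (k + 1)` is at most
-- `θ`.
open Classical in
theorem le_card_filter_digitSet {ψ : ℝ → ℝ} (hψ : ClassA 1 ψ) {θ : ℝ} (hθ : θ ∈ Ioo (0 : ℝ) 1)
    (D : ℕ) (M : ℝ) : ∃ N : ℕ, 1 ≤ N ∧ M ≤ N ∧ ψ θ * (N - θ * N) - (D + 3)
      ≤ ((Finset.Ico (⌈θ * N⌉₊ + D) (N - 1)).filter (· ∈ digitSet ψ)).card := by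
  obtain ⟨k₁, hk₁⟩ := exists_nat_ge M
  obtain ⟨k₂, hk₂⟩ := exists_nat_one_div_lt hθ.1
  set k := max k₁ k₂
  have hθ0 := hθ.1
  have hk : 1 / ((k : ℝ) + 1) ≤ θ := by
    refine le_trans (one_div_le_one_div_of_le (by positivity) ?_) hk₂.le
    have : (k₂ : ℝ) ≤ k := by exact_mod_cast le_max_right k₁ k₂
    linarith
  have hNpos := blockEnd_pos k
  refine ⟨blockEnd k, hNpos, ?_, ?_⟩
  · have : k₁ ≤ blockEnd k := (le_max_left k₁ k₂).trans (le_blockEnd k)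
    exact hk₁.trans (by exact_mod_cast this)
  have heq := profile_blockEnd_sub (ψ := ψ) hθ hk
  have hD : (0 : ℝ) ≤ D := by positivity
  generalize hN : blockEnd k = N at *
  set X := θ * N with hX
  have hX0 : 0 ≤ X := by positivity
  set m := ⌈X⌉₊ + D with hm
  have hm1 : X ≤ m := by
    rw [hm]; push_cast; linarith [Nat.le_ceil X]
  have hm2 : (m : ℝ) ≤ X + 1 + D := by
    rw [hm]; push_cast; linarith [Nat.ceil_lt_add_one hX0]
  have hn : ((N - 1 : ℕ) : ℝ) = N - 1 := by
    rw [Nat.cast_sub hNpos, Nat.cast_one]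
  rcases le_or_gt m (N - 1) with hmn | hmn
  · have h1 : ((Finset.Ico m (N - 1)).filter (· ∈ jumpSet ψ k)).card
        ≤ ((Finset.Ico m (N - 1)).filter (· ∈ digitSet ψ)).card :=
      Finset.card_le_card fun b hb => by
        rw [Finset.mem_filter] at hb ⊢
        exact ⟨hb.1, mem_iUnion.2 ⟨k, hb.2⟩⟩
    have h1' : (((Finset.Ico m (N - 1)).filter (· ∈ jumpSet ψ k)).card : ℝ)
        ≤ ((Finset.Ico m (N - 1)).filter (· ∈ digitSet ψ)).card := by exact_mod_cast h1
    have h2 := (card_filter_jumpSet_bounds hψ k hmn).2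
    have h3 := profile_sub_le (k := k) hψ hm1
    have h4 := profile_sub_le (k := k) hψ (show ((N - 1 : ℕ) : ℝ) ≤ N by rw [hn]; linarith)
    rw [hn] at h2 h4
    linarith
  · have hmn' : ((N - 1 : ℕ) : ℝ) < m := by exact_mod_cast hmn
    have h1 : ψ θ ≤ 1 := by simpa using (hψ.1 θ hθ).2
    have h2 : 0 ≤ (N : ℝ) - X := by
      have : (0 : ℝ) ≤ N := by positivity
      nlinarith [hθ.2]
    have h3 : (0 : ℝ) ≤ ((Finset.Ico m (N - 1)).filter (· ∈ digitSet ψ)).card := by positivity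
    rw [hn] at hmn'
    nlinarith

/-! ### Cubes of numbers with restricted binary digits -/

open Classical in
/-- The contribution of the `j`-th binary digit, dropped if `j ∉ S`. -/
noncomputable def digitTerm (S : Set ℕ) (b : ℕ → Bool) (j : ℕ) : ℝ :=
  if b j = true ∧ j ∈ S then (1 / 2 : ℝ) ^ (j + 1) else 0

/-- The number with binary digits `b j`, where the digits at positions outside `S` are dropped. -/
noncomputable def digitPoint (S : Set ℕ) (b : ℕ → Bool) : ℝ :=
  ∑' j, digitTerm S b j

/-- The `d`-th power of the set of all numbers in `[0, 1]` with binary digits supported on `S`. -/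
def digitCube (d : ℕ) (S : Set ℕ) : Set (EuclideanSpace ℝ (Fin d)) :=
  range fun b : Fin d → ℕ → Bool => WithLp.toLp 2 fun i => digitPoint S (b i)

theorem summable_half_pow_succ : Summable fun j : ℕ => (1 / 2 : ℝ) ^ (j + 1) :=
  (summable_nat_add_iff 1).2 summable_geometric_two

theorem digitTerm_bounds (S : Set ℕ) (b : ℕ → Bool) (j : ℕ) :
    0 ≤ digitTerm S b j ∧
    digitTerm S b j ≤ (1 / 2 : ℝ) ^ (j + 1) := by
  unfold digitTerm
  split_ifs
  · exact ⟨by positivity, le_rfl⟩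
  · exact ⟨le_rfl, by positivity⟩

theorem continuous_digitPoint (S : Set ℕ) : Continuous (digitPoint S) := by
  classical
  refine continuous_tsum (fun j => ?_) summable_half_pow_succ fun j b => ?_
  · exact (continuous_of_discreteTopology
      (f := fun c : Bool => if c = true ∧ j ∈ S then (1 / 2 : ℝ) ^ (j + 1) else 0)).comp
      (continuous_apply j)
  · rw [Real.norm_eq_abs, abs_of_nonneg (digitTerm_bounds S b j).1]
    exact (digitTerm_bounds S b j).2

theorem isCompact_digitCube (d : ℕ) (S : Set ℕ) : IsCompact (digitCube d S) := by
  refine isCompact_range ((PiLp.continuous_toLp 2 _).comp (continuous_pi fun i => ?_))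
  exact (continuous_digitPoint S).comp (continuous_apply i)

theorem digitPoint_sub_sum_bounds (S : Set ℕ) (b : ℕ → Bool) (n : ℕ) :
    0 ≤ digitPoint S b -
      ∑ j ∈ Finset.range n, digitTerm S b j ∧
    digitPoint S b -
      ∑ j ∈ Finset.range n, digitTerm S b j
        ≤ (1 / 2) ^ n := by
  have hb := digitTerm_bounds S b
  rw [digitPoint]
  generalize digitTerm S b = f at hb ⊢
  have hsum : Summable f := Summable.of_nonneg_of_le (fun j => (hb j).1) (fun j => (hb j).2)
    summable_half_pow_succ
  rw [← hsum.sum_add_tsum_nat_add n, add_sub_cancel_left]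
  refine ⟨tsum_nonneg fun j => (hb _).1, ?_⟩
  have h1 : ∑' j, f (j + n) ≤ ∑' j : ℕ, (1 / 2 : ℝ) ^ (n + 1) * (1 / 2) ^ j :=
    Summable.tsum_le_tsum (fun j => (hb (j + n)).2.trans (le_of_eq (by ring)))
      ((summable_nat_add_iff n).2 hsum) (summable_geometric_two.mul_left _)
  refine h1.trans (le_of_eq ?_)
  rw [tsum_mul_left, tsum_geometric_two]
  ring

theorem digitPoint_decide {S : Set ℕ} {A : Finset ℕ} (hA : ∀ j ∈ A, j ∈ S) :
    digitPoint S (fun j => decide (j ∈ A)) = ∑ j ∈ A, (1 / 2 : ℝ) ^ (j + 1) := by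
  classical
  rw [digitPoint, tsum_eq_sum (s := A)]
  · exact Finset.sum_congr rfl fun j hj => by simp [digitTerm, hj, hA j hj]
  · intro j hj
    simp [digitTerm, hj]

theorem exists_int_sum_digits (S : Set ℕ) (b : ℕ → Bool) (m : ℕ) :
    ∃ z : ℤ, ∑ j ∈ Finset.range m, digitTerm S b j
      = z * (1 / 2) ^ m := by
  induction m with
  | zero => exact ⟨0, by simp⟩
  | succ m ih =>
    obtain ⟨z, hz⟩ := ih
    rw [Finset.sum_range_succ, hz, digitTerm]
    split_ifs
    · exact ⟨2 * z + 1, by push_cast; ring⟩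
    · exact ⟨2 * z, by push_cast; ring⟩

-- In each coordinate the first `m` digits form an integer multiple of `(1 / 2) ^ m` with at most
-- five possible values near `x i`. The digits in `[m, n)` contribute a subset of the permitted
-- positions, and the tail is at most `(1 / 2) ^ n`.
open Classical in
theorem coveringCount_digitCube_le {d : ℕ} {S : Set ℕ} {m n : ℕ} (hmn : m ≤ n) {δ δ' : ℝ}
    (hδ : δ ≤ (1 / 2) ^ m) (hδ' : d * (1 / 2 : ℝ) ^ n < δ') (x : EuclideanSpace ℝ (Fin d)) :
    coveringCount δ' (digitCube d S ∩ ball x δ)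
      ≤ (5 * 2 ^ ((Finset.Ico m n).filter (· ∈ S)).card) ^ d := by
  set V := (Finset.Ico m n).filter (· ∈ S) with hV
  have h2m : (1 / 2 : ℝ) ^ m * 2 ^ m = 1 := by rw [← mul_pow]; norm_num
  have hm0 : (0 : ℝ) < 2 ^ m := by positivity
  refine coveringCount_le_pow (h := (1 / 2) ^ n)
    (fun i => (Finset.Icc (⌊2 ^ m * x i⌋ - 2) (⌊2 ^ m * x i⌋ + 2) ×ˢ V.powerset).image
      fun q : ℤ × Finset ℕ => q.1 * (1 / 2 : ℝ) ^ m + ∑ j ∈ q.2, (1 / 2 : ℝ) ^ (j + 1)) hδ' ?_ ?_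
  · intro i
    refine Finset.card_image_le.trans (le_of_eq ?_)
    rw [Finset.card_product, Finset.card_powerset, Int.card_Icc]
    congr 1
    omega
  · rintro _ ⟨⟨b, rfl⟩, hy⟩ i
    have hyi : |digitPoint S (b i) - x i| < δ := by
      refine lt_of_le_of_lt ?_ (mem_ball_iff_norm.1 hy)
      simpa using EuclideanSpace.abs_apply_le_norm
        (WithLp.toLp 2 (fun i => digitPoint S (b i)) - x) i
    obtain ⟨z, hz⟩ := exists_int_sum_digits S (b i) m
    have hm := digitPoint_sub_sum_bounds S (b i) m
    have hn := digitPoint_sub_sum_bounds S (b i) n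
    rw [hz] at hm
    rw [abs_lt] at hyi
    have hlo : 2 ^ m * x i - 2 ≤ z := by
      have h1 : x i ≤ z * (1 / 2) ^ m + 2 * (1 / 2) ^ m := by linarith
      have h2 := mul_le_mul_of_nonneg_left h1 hm0.le
      have h3 : (2 : ℝ) ^ m * (z * (1 / 2) ^ m + 2 * (1 / 2) ^ m) = z + 2 := by
        linear_combination (z + 2 : ℝ) * h2m
      linarith
    have hhi : (z : ℝ) ≤ 2 ^ m * x i + 2 := by
      have h1 : z * (1 / 2) ^ m - 2 * (1 / 2) ^ m ≤ x i := by
        have : (0 : ℝ) < (1 / 2) ^ m := by positivity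
        linarith
      have h2 := mul_le_mul_of_nonneg_left h1 hm0.le
      have h3 : (2 : ℝ) ^ m * (z * (1 / 2) ^ m - 2 * (1 / 2) ^ m) = z - 2 := by
        linear_combination (z - 2 : ℝ) * h2m
      linarith
    have hz1 : ⌊2 ^ m * x i⌋ - 2 ≤ z := by
      have := Int.floor_le (2 ^ m * x i)
      have : ((⌊2 ^ m * x i⌋ - 2 : ℤ) : ℝ) ≤ z := by push_cast; linarith
      exact Int.cast_le.1 this
    have hz2 : z < ⌊2 ^ m * x i⌋ + 3 := by
      have := Int.lt_floor_add_one (2 ^ m * x i)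
      have : (z : ℝ) < ((⌊2 ^ m * x i⌋ + 3 : ℤ) : ℝ) := by push_cast; linarith
      exact Int.cast_lt.1 this
    refine ⟨_, Finset.mem_image.2 ⟨(z, V.filter fun j => b i j = true), Finset.mem_product.2
      ⟨Finset.mem_Icc.2 ⟨hz1, by omega⟩, Finset.mem_powerset.2 (Finset.filter_subset _ _)⟩,
      rfl⟩, ?_⟩
    have hsplit : (z : ℝ) * (1 / 2) ^ m
        + ∑ j ∈ V.filter (fun j => b i j = true), (1 / 2 : ℝ) ^ (j + 1)
        = ∑ j ∈ Finset.range n, digitTerm S (b i) j := by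
      rw [← hz, ← Finset.sum_range_add_sum_Ico _ hmn, hV, Finset.filter_filter,
        Finset.sum_filter]
      simp only [digitTerm, and_comm]
    change |digitPoint S (b i) - ((z : ℝ) * (1 / 2) ^ m
        + ∑ j ∈ V.filter (fun j => b i j = true), (1 / 2 : ℝ) ^ (j + 1))| ≤ _
    rw [hsplit, abs_of_nonneg hn.1]
    exact hn.2

/-- After multiplication by `2 ^ n` both sums are natural numbers, distinct by uniqueness of binary
expansions. -/
theorem half_pow_le_abs_sum_sub_sum {n : ℕ} {A B : Finset ℕ} (hA : ∀ j ∈ A, j < n)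
    (hB : ∀ j ∈ B, j < n) (hAB : A ≠ B) :
    (1 / 2 : ℝ) ^ n ≤ |∑ j ∈ A, (1 / 2 : ℝ) ^ (j + 1) - ∑ j ∈ B, (1 / 2 : ℝ) ^ (j + 1)| := by
  classical
  have hinj : ∀ A : Finset ℕ, (∀ j ∈ A, j < n) → Set.InjOn (fun j => n - 1 - j) A := by
    intro A hA i hi j hj hij
    have := hA i hi
    have := hA j hj
    simp only at hij
    omega
  have hsum : ∀ A : Finset ℕ, (∀ j ∈ A, j < n) → ∑ j ∈ A, (1 / 2 : ℝ) ^ (j + 1)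
      = (1 / 2) ^ n * ((∑ i ∈ A.image fun j => n - 1 - j, 2 ^ i : ℕ) : ℝ) := by
    intro A hA
    rw [Finset.sum_image (hinj A hA)]
    push_cast
    rw [Finset.mul_sum]
    refine Finset.sum_congr rfl fun j hj => ?_
    have h1 : n = (j + 1) + (n - 1 - j) := by have := hA j hj; omega
    have h2 : (1 / 2 : ℝ) ^ n = (1 / 2) ^ (j + 1) * (1 / 2) ^ (n - 1 - j) := by
      rw [← pow_add, ← h1]
    rw [h2, mul_assoc, ← mul_pow]
    norm_num
  have hne : (∑ i ∈ A.image (fun j => n - 1 - j), 2 ^ i : ℕ)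
      ≠ ∑ i ∈ B.image (fun j => n - 1 - j), 2 ^ i := by
    intro h
    have h' := Finset.geomSum_injective le_rfl h
    have hsub : ∀ A B : Finset ℕ, (∀ j ∈ A, j < n) → (∀ j ∈ B, j < n) →
        A.image (fun j => n - 1 - j) = B.image (fun j => n - 1 - j) → A ⊆ B := by
      intro A B hA hB h j hj
      have h1 : n - 1 - j ∈ B.image fun j => n - 1 - j := h ▸ Finset.mem_image_of_mem _ hj
      obtain ⟨i, hi, hij⟩ := Finset.mem_image.1 h1
      have := hA j hj
      have := hB i hi
      have : i = j := by omega
      exact this ▸ hi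
    exact hAB (Finset.Subset.antisymm (hsub A B hA hB h') (hsub B A hB hA h'.symm))
  rw [hsum A hA, hsum B hB, ← mul_sub, abs_mul, abs_of_pos (by positivity : (0 : ℝ) < (1 / 2) ^ n)]
  refine le_mul_of_one_le_right (by positivity) ?_
  have : (1 : ℤ) ≤ |((∑ i ∈ A.image (fun j => n - 1 - j), 2 ^ i : ℕ) : ℤ)
      - (∑ i ∈ B.image (fun j => n - 1 - j), 2 ^ i : ℕ)| := by
    refine Int.one_le_abs (sub_ne_zero.2 ?_)
    exact_mod_cast hne
  exact_mod_cast this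

theorem sum_half_pow_le {m : ℕ} {A : Finset ℕ} (hA : ∀ j ∈ A, m ≤ j) :
    ∑ j ∈ A, (1 / 2 : ℝ) ^ (j + 1) ≤ (1 / 2) ^ m := by
  classical
  have h1 := (digitPoint_sub_sum_bounds univ (fun j => decide (j ∈ A)) m).2
  have h2 : ∑ j ∈ Finset.range m,
      digitTerm univ (fun j => decide (j ∈ A)) j = 0 := by
    refine Finset.sum_eq_zero fun j hj => if_neg ?_
    rintro ⟨h, -⟩
    have := hA j (by simpa using h)
    have := Finset.mem_range.1 hj
    omega
  rwa [digitPoint_decide fun _ _ => mem_univ _, h2, sub_zero] at h1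

theorem zero_mem_digitCube (d : ℕ) (S : Set ℕ) : (0 : EuclideanSpace ℝ (Fin d)) ∈ digitCube d S :=
  ⟨fun _ _ => false, by ext i; simp [digitPoint, digitTerm]⟩

-- Choosing the digits at the permitted positions of `[m, n)` freely in each coordinate gives points
-- near the origin that are `(1 / 2) ^ n`-separated.
open Classical in
theorem le_coveringCount_digitCube {d : ℕ} {S : Set ℕ} {m n : ℕ} {δ δ' : ℝ} (h0 : 0 < δ')
    (hδ : d * (1 / 2 : ℝ) ^ m < δ) (hδ' : 2 * δ' ≤ (1 / 2) ^ n) :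
    (2 ^ ((Finset.Ico m n).filter (· ∈ S)).card) ^ d
      ≤ coveringCount δ' (digitCube d S ∩ ball 0 δ) := by
  set V := (Finset.Ico m n).filter (· ∈ S) with hV
  have hVmem : ∀ j ∈ V, m ≤ j ∧ j < n ∧ j ∈ S := fun j hj => by
    rw [hV, Finset.mem_filter, Finset.mem_Ico] at hj
    exact ⟨hj.1.1, hj.1.2, hj.2⟩
  have hmem : ∀ (A : Fin d → V.powerset) (i : Fin d), ∀ j ∈ (A i).1, m ≤ j ∧ j < n ∧ j ∈ S :=
    fun A i j hj => hVmem j (Finset.mem_powerset.1 (A i).2 hj)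
  have hcard : Fintype.card (Fin d → V.powerset) = (2 ^ V.card) ^ d := by
    simp
  rw [← hcard]
  refine card_le_coveringCount h0 (isBounded_ball.subset inter_subset_right)
    (fun A => WithLp.toLp 2 fun i => ∑ j ∈ (A i).1, (1 / 2 : ℝ) ^ (j + 1)) (fun A => ⟨?_, ?_⟩) ?_
  · refine ⟨fun i j => decide (j ∈ (A i).1), ?_⟩
    ext i
    exact digitPoint_decide fun j hj => (hmem A i j hj).2.2
  · rw [mem_ball_zero_iff]
    refine lt_of_le_of_lt (EuclideanSpace.norm_le_card_mul fun i => ?_) hδ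
    change |∑ j ∈ (A i).1, (1 / 2 : ℝ) ^ (j + 1)| ≤ _
    rw [abs_of_nonneg (Finset.sum_nonneg fun j _ => by positivity)]
    exact sum_half_pow_le fun j hj => (hmem A i j hj).1
  · intro A B hAB
    obtain ⟨i, hi⟩ := Function.ne_iff.1 hAB
    refine hδ'.trans ((half_pow_le_abs_sum_sub_sum (fun j hj => (hmem A i j hj).2.1)
      (fun j hj => (hmem B i j hj).2.1) fun h => hi (Subtype.ext h)).trans ?_)
    rw [dist_eq_norm]
    exact EuclideanSpace.abs_apply_le_norm (WithLp.toLp 2 (fun i => ∑ j ∈ (A i).1,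
      (1 / 2 : ℝ) ^ (j + 1)) - WithLp.toLp 2 fun i => ∑ j ∈ (B i).1, (1 / 2 : ℝ) ^ (j + 1)) i

/-! ### The Assouad spectrum of a digit cube and the conclusion -/

theorem half_pow_eq_rpow (n : ℕ) : (1 / 2 : ℝ) ^ n = 2 ^ (-(n : ℝ)) := by
  rw [Real.rpow_neg zero_le_two, Real.rpow_natCast, one_div, inv_pow]

theorem natCast_mul_half_pow_lt {d n : ℕ} {Y : ℝ} (h : Y + d ≤ n) :
    d * (1 / 2 : ℝ) ^ n < 2 ^ (-Y) := by
  have h1 : (d : ℝ) < 2 ^ (d : ℝ) := by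
    rw [Real.rpow_natCast]
    exact_mod_cast Nat.lt_two_pow_self
  calc d * (1 / 2 : ℝ) ^ n < 2 ^ (d : ℝ) * (1 / 2 : ℝ) ^ n :=
        mul_lt_mul_of_pos_right h1 (by positivity)
    _ = 2 ^ ((d : ℝ) - n) := by
        rw [half_pow_eq_rpow, ← Real.rpow_add zero_lt_two, sub_eq_add_neg]
    _ ≤ 2 ^ (-Y) := Real.rpow_le_rpow_of_exponent_le one_le_two (by linarith)

theorem assouadSpectrum_digitCube {d : ℕ} {ψ : ℝ → ℝ} (hψ : ClassA 1 ψ) {θ : ℝ}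
    (hθ : θ ∈ Ioo (0 : ℝ) 1) :
    assouadSpectrum (digitCube d (digitSet ψ)) θ = d * ψ θ := by
  classical
  have hθ0 := hθ.1
  refine IsLeast.csInf_eq ⟨?_, ?_⟩
  · obtain ⟨C, hC⟩ := card_filter_digitSet_le hψ hθ d
    refine ⟨5 ^ d * 2 ^ (d * C), by positivity, fun δ hδ hδ1 x _ => ?_⟩
    obtain ⟨X, rfl⟩ : ∃ X : ℝ, δ = 2 ^ (-X) :=
      ⟨-Real.logb 2 δ, by rw [neg_neg, Real.rpow_logb zero_lt_two (by norm_num) hδ]⟩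
    have hX : 0 ≤ X := by
      by_contra! hneg
      exact (Real.one_lt_rpow one_lt_two (neg_pos.2 hneg)).not_ge hδ1
    have eδ' : ((2 : ℝ) ^ (-X)) ^ (1 / θ) = 2 ^ (-(X / θ)) := by
      rw [← Real.rpow_mul zero_le_two]
      congr 1
      ring
    have eq : (2 : ℝ) ^ (-X) / 2 ^ (-(X / θ)) = 2 ^ (X / θ - X) := by
      rw [← Real.rpow_sub zero_lt_two]
      congr 1
      ring
    have hm : (⌊X⌋₊ : ℝ) ≤ X := Nat.floor_le hX
    have hn : X / θ ≤ ⌈X / θ⌉₊ := Nat.le_ceil _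
    have hXθ : X ≤ X / θ := le_div_self hX hθ.1 hθ.2.le
    have hmn : ⌊X⌋₊ ≤ ⌈X / θ⌉₊ + d := by
      have : (⌊X⌋₊ : ℝ) ≤ ⌈X / θ⌉₊ := by linarith
      have : ⌊X⌋₊ ≤ ⌈X / θ⌉₊ := by exact_mod_cast this
      omega
    have h1 := coveringCount_digitCube_le (S := digitSet ψ) hmn (δ := 2 ^ (-X))
      (δ' := 2 ^ (-(X / θ))) (by
        rw [half_pow_eq_rpow]
        exact Real.rpow_le_rpow_of_exponent_le one_le_two (by linarith))
      (natCast_mul_half_pow_lt (by push_cast; linarith)) x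
    rw [eδ', eq]
    have h2 := hC X hX
    generalize ((Finset.Ico ⌊X⌋₊ (⌈X / θ⌉₊ + d)).filter (· ∈ digitSet ψ)).card = N at h1 h2
    calc _ ≤ ((5 * 2 ^ N) ^ d : ℝ) := by exact_mod_cast h1
      _ = 5 ^ d * 2 ^ ((N : ℝ) * d) := by
          rw [mul_pow, Real.rpow_mul zero_le_two, Real.rpow_natCast, Real.rpow_natCast]
      _ ≤ 5 ^ d * 2 ^ ((ψ θ * (X / θ - X) + C) * d) := by
          refine mul_le_mul_of_nonneg_left ?_ (by positivity)
          exact Real.rpow_le_rpow_of_exponent_le one_le_two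
            (mul_le_mul_of_nonneg_right h2 (by positivity))
      _ = _ := by
          rw [← Real.rpow_mul zero_le_two, mul_assoc, ← Real.rpow_add zero_lt_two]
          congr 2
          ring
  · rintro α ⟨C, hC, h⟩
    by_contra! hα
    have hgap : 0 < (1 - θ) * (d * ψ θ - α) := mul_pos (by linarith [hθ.2]) (by linarith)
    -- At scales `2 ^ (-(θ * N))` and `2 ^ (-N)` the exponents differ by at least `N * (1 - θ) * (d
    -- * ψ θ - α)`, less the rounding loss `d * (d + 3)`. Beyond this threshold for `N` that exceeds
    -- `Real.logb 2 C`.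
    obtain ⟨N, hN1, hNM, hN⟩ := le_card_filter_digitSet hψ hθ d
      ((Real.logb 2 C + d * (d + 3)) / ((1 - θ) * (d * ψ θ - α)) + 1)
    have hX0 : 0 ≤ θ * N := by positivity
    have h1 := h (2 ^ (-(θ * N))) (by positivity)
      (Real.rpow_le_one_of_one_le_of_nonpos one_le_two (by linarith)) 0 (zero_mem_digitCube d _)
    have eδ' : ((2 : ℝ) ^ (-(θ * N))) ^ (1 / θ) = 2 ^ (-(N : ℝ)) := by
      rw [← Real.rpow_mul zero_le_two]
      congr 1
      field_simp
    have eq : (2 : ℝ) ^ (-(θ * N)) / 2 ^ (-(N : ℝ)) = 2 ^ (N - θ * N) := by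
      rw [← Real.rpow_sub zero_lt_two]
      congr 1
      ring
    rw [eδ', eq, ← Real.rpow_mul zero_le_two] at h1
    -- Stopping at `N - 1` provides the separation of twice the radius `2 ^ (-N)`; starting `d`
    -- positions late keeps the points inside the ball.
    have h2 := le_coveringCount_digitCube (d := d) (S := digitSet ψ) (m := ⌈θ * N⌉₊ + d)
      (n := N - 1) (δ := 2 ^ (-(θ * N))) (δ' := 2 ^ (-(N : ℝ))) (by positivity)
      (natCast_mul_half_pow_lt (by push_cast; linarith [Nat.le_ceil (θ * N)])) (by
        rw [← half_pow_eq_rpow]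
        obtain ⟨k, rfl⟩ : ∃ k, N = k + 1 := ⟨N - 1, by omega⟩
        rw [Nat.add_sub_cancel, pow_succ]
        linarith)
    generalize ((Finset.Ico (⌈θ * N⌉₊ + d) (N - 1)).filter (· ∈ digitSet ψ)).card = M at hN h2
    have h3 : ((2 ^ M) ^ d : ℝ) ≤ C * 2 ^ ((N - θ * N) * α) :=
      le_trans (by exact_mod_cast h2) h1
    have h4 : (2 : ℝ) ^ ((M : ℝ) * d) ≤ 2 ^ (Real.logb 2 C + (N - θ * N) * α) := by
      rw [Real.rpow_add zero_lt_two, Real.rpow_logb zero_lt_two (by norm_num) hC,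
        Real.rpow_mul zero_le_two, Real.rpow_natCast, Real.rpow_natCast]
      exact h3
    have h5 := (Real.rpow_le_rpow_left_iff one_lt_two).1 h4
    have h6 := mul_le_mul_of_nonneg_right hN (show (0 : ℝ) ≤ d by positivity)
    have h7 : (Real.logb 2 C + d * (d + 3)) / ((1 - θ) * (d * ψ θ - α)) < N := by linarith
    rw [div_lt_iff₀ hgap] at h7
    nlinarith

theorem NonMonotoneOnEveryOpen.congr {f g : ℝ → ℝ} (hf : NonMonotoneOnEveryOpen f)
    (h : EqOn f g (Ioo 0 1)) : NonMonotoneOnEveryOpen g := fun U hU hne hU1 =>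
  ⟨fun hg => (hf U hU hne hU1).1 (hg.congr fun _ hx => (h (hU1 hx)).symm),
    fun hg => (hf U hU hne hU1).2 (hg.congr fun _ hx => (h (hU1 hx)).symm)⟩

/-- The existence of `η < ε` bounding the difference on `(0,1)` says that the sup norm of the
difference on `(0,1)` is less than `ε`. -/
theorem theoremC (d : ℕ) (hd : 1 ≤ d) (φ : ℝ → ℝ)
    (hφ : ∀ θ ∈ Set.Ioo (0 : ℝ) 1, φ θ ∈ Set.Icc (0 : ℝ) d)
    (h : (ClassA d φ ∧ MonotoneOn φ (Set.Ioo 0 1)) ∨ IsUpperAssouadSpectrum d φ ∨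
      IncreasingWithDecreasingRate φ ∨ IsSupOfElementary d φ)
    (ε : ℝ) (hε : 0 < ε) :
    ∃ F : Set (EuclideanSpace ℝ (Fin d)), F.Nonempty ∧ IsCompact F ∧
      NonMonotoneOnEveryOpen (assouadSpectrum F) ∧
      ∃ η : ℝ, η < ε ∧ ∀ θ ∈ Set.Ioo (0 : ℝ) 1, |assouadSpectrum F θ - φ θ| ≤ η := by
  have hrate : IncreasingWithDecreasingRate φ := by
    rcases h with h | h | h | h
    · exact .of_classA h.1 h.2
    · exact .of_isUpperAssouadSpectrum h
    · exact h
    · exact .of_isSupOfElementary h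
  obtain ⟨g, hgA, hgn, hgφ⟩ := hrate.exists_classA_near hd hφ (half_pos hε)
  have hd0 : (d : ℝ) ≠ 0 := by exact_mod_cast (by omega : d ≠ 0)
  have hspec : EqOn g (assouadSpectrum (digitCube d (digitSet fun θ => g θ / d))) (Ioo 0 1) := by
    intro θ hθ
    rw [assouadSpectrum_digitCube (hgA.div_natCast hd) hθ, mul_div_cancel₀ _ hd0]
  refine ⟨digitCube d (digitSet fun θ => g θ / d), ⟨0, zero_mem_digitCube _ _⟩,
    isCompact_digitCube _ _, hgn.congr hspec, ε / 2, half_lt_self hε, fun θ hθ => ?_⟩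
  rw [← hspec hθ]
  exact hgφ θ hθ
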